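/- **Setting.** Let $m,n\ge 1$ and let $\mathbf r\in\mathbb R_{\ge0}^m$, $\mathbf c\in\mathbb R_{\ge0}^n$ be a margin with common total sum $N=\sum_i \mathbf r(i)=\sum_j\mathbf c(j)>0$ that is $\delta$-smooth for some $\delta>0$: $\delta N/m\le \mathbf r(i)\le N/(\delta m)$ and $\delta N/n\le \mathbf c(j)\le N/(\delta n)$ for all $i,j$. A nonnegative $m\times n$ matrix $\mathbf A$ is *scalable* to $(\mathbf r,\mathbf c)$ if there are positive diagonal matrices $\mathbf D_1,\mathbf D_2$ such that $\mathbf D_1\mathbf A\mathbf D_2$ has row sums $\mathbf r$ and column sums $\mathbf c$; the matrix $\mathbf A^{\mathbf r,\mathbf c}:=\mathbf D_1\mathbf A\mathbf D_2$ is then unique. Its piecewise constant extension is $\varphi_{\mathbf A^{\mathbf r,\mathbf c}}(x,y)=\frac{mn}{N}\mathbf A^{\mathbf r,\mathbf c}(\lceil mx\rceil,\lceil ny\rceil)$ on $[0,1]^2$. Let $\mathbf X$ be an $m\times n$ random matrix with independent nonnegative entries and entrywise positive mean $\boldsymbol\Lambda=\mathbb E[\mathbf X]$, and let $\sigma,R>0$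 be such that $\mathbb E|\mathbf X_{ij}-\boldsymbol\Lambda_{ij}|^q\le\frac{q!}{2}\sigma^2R^{q-2}$ for all $i,j$ and all integers $q\ge2$. Write $\|\boldsymbol\Lambda\|_1=\sum_{i,j}\boldsymbol\Lambda_{ij}$, $\boldsymbol\Lambda_{\min}=\min_{i,j}\boldsymbol\Lambda_{ij}$, $\boldsymbol\Lambda_{\max}=\max_{i,j}\boldsymbol\Lambda_{ij}$. Let $K\ge0$ satisfy $$\left|\log\frac{\mathbf r(i)\mathbf c(j)\|\boldsymbol\Lambda\|_1}{\boldsymbol\Lambda_{ij}N^2}\right|\le K\quad\text{for all } i,j.$$ For $D>0$ put $\tau=(D+1)\log(m\vee n)+\log 4$, $$\varepsilon_0=\frac{e^{2K}(m\vee n)}{\delta\|\boldsymbol\Lambda\|_1}\left(\sigma\sqrt{2(m\vee n)\tau}+2R\tau\right),\qquad C_*=1+\frac{18e^{8K}\|\boldsymbol\Lambda\|_1^2}{\delta^2\boldsymbol\Lambda_{\min}^2m^2n^2},\qquad \varepsilon_{\mathrm{pot}}=16\,C_*\,\varepsilon_0,$$ $$\Phi_{\boldsymbol\Lambda}=\min\left(n\frac{\boldsymbol\Lambda_{\min}^4}{(\sigma+R+\boldsymbol\Lambda_{\max})^4},\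 \sqrt n\,\frac{\boldsymbol\Lambda_{\min}}{\sigma+R+\boldsymbol\Lambda_{\max}}\right).$$ **Theorem.** There is an absolute constant $c>0$ such that the following holds for all data as above, every $D>0$ with $\varepsilon_{\mathrm{pot}}\le1$, and every $g\in L^\infty([0,1]^2)$. The matrix $\boldsymbol\Lambda$ is scalable to $(\mathbf r,\mathbf c)$, and with probability at least $$1-2(m\vee n)^{-D}-m^2\exp(-c\,\Phi_{\boldsymbol\Lambda})-2\exp\left(-\frac{\|\boldsymbol\Lambda\|_1^2/2}{mn\sigma^2+R\|\boldsymbol\Lambda\|_1}\right),$$ the matrix $\mathbf X$ is scalable to $(\mathbf r,\mathbf c)$ and $$\left|\int_{[0,1]^2}g\,\bigl(\varphi_{\mathbf X^{\mathbf r,\mathbf c}}-\varphi_{\boldsymbol\Lambda^{\mathbf r,\mathbf c}}\bigr)\,dx\,dy\right|\le 2\|g\|_\infty\,\varepsilon_{\mathrm{pot}}\,e^{2K}+\frac{\|g\|_\infty e^{2K}}{\|\boldsymbol\Lambda\|_1}\left(\sigma\sqrt{2mn\tau}+2R\tau\right).$$ -/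

import Mathlib

open MeasureTheory ProbabilityTheory

noncomputable section

namespace MatrixScaling

/-- An `m × n` margin: two nonnegative vectors with the same total sum. -/
def IsMargin {m n : ℕ} (r : Fin m → ℝ) (c : Fin n → ℝ) : Prop :=
  (∀ i, 0 ≤ r i) ∧ (∀ j, 0 ≤ c j) ∧ ∑ i, r i = ∑ j, c j

/-- The total sum `N` of a margin `(r, c)`. -/
def total {m : ℕ} (r : Fin m → ℝ) : ℝ := ∑ i, r i

/-- `δ`-smoothness of a margin. -/
def IsSmoothMargin {m n : ℕ} (δ : ℝ) (r : Fin m → ℝ) (c : Fin n → ℝ) : Prop :=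
  IsMargin r c ∧ 0 < δ ∧
  (∀ i, δ * total r / m ≤ r i ∧ r i ≤ total r / (δ * m)) ∧
  (∀ j, δ * total r / n ≤ c j ∧ c j ≤ total r / (δ * n))

/-- The transportation polytope: nonnegative matrices with row sums `r` and column sums `c`. -/
def transportPolytope {m n : ℕ} (r : Fin m → ℝ) (c : Fin n → ℝ) :
    Set (Matrix (Fin m) (Fin n) ℝ) :=
  {Z | (∀ i j, 0 ≤ Z i j) ∧ (∀ i, ∑ j, Z i j = r i) ∧ (∀ j, ∑ i, Z i j = c j)}

/-- `B` is a matrix `D₁ A D₂`, with `D₁, D₂` positive diagonal, that has margin `(r, c)`. -/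
def IsRescaling {m n : ℕ} (A : Matrix (Fin m) (Fin n) ℝ) (r : Fin m → ℝ) (c : Fin n → ℝ)
    (B : Matrix (Fin m) (Fin n) ℝ) : Prop :=
  ∃ (a : Fin m → ℝ) (b : Fin n → ℝ), (∀ i, 0 < a i) ∧ (∀ j, 0 < b j) ∧
    B = Matrix.diagonal a * A * Matrix.diagonal b ∧ B ∈ transportPolytope r c

/-- The nonnegative matrices that are scalable to the margin `(r, c)`. -/
def IsScalable {m n : ℕ} (A : Matrix (Fin m) (Fin n) ℝ) (r : Fin m → ℝ) (c : Fin n → ℝ) : Prop :=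
  (∀ i j, 0 ≤ A i j) ∧ ∃ B, IsRescaling A r c B

open Classical in
/-- The rescaled matrix `A^{r,c} = D₁ A D₂`. It is uniquely determined whenever `A` can be
rescaled to `(r, c)` (see `IsRescaling.unique`), and it is set to `0` otherwise. -/
def rescaled {m n : ℕ} (A : Matrix (Fin m) (Fin n) ℝ) (r : Fin m → ℝ) (c : Fin n → ℝ) :
    Matrix (Fin m) (Fin n) ℝ :=
  if h : ∃ B, IsRescaling A r c B then Classical.choose h else 0

theorem IsRescaling.unique {m n : ℕ} {A : Matrix (Fin m) (Fin n) ℝ} {r : Fin m → ℝ}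
    {c : Fin n → ℝ} {B B' : Matrix (Fin m) (Fin n) ℝ}
    (h : IsRescaling A r c B) (h' : IsRescaling A r c B') : B = B' := by
  obtain ⟨a, b, ha, hb, hB, hB0, hBr, hBc⟩ := h
  obtain ⟨a', b', ha', hb', hB', -, hBr', hBc'⟩ := h'
  have e : ∀ i j, B i j = a i * A i j * b j := fun i j => by
    rw [hB, Matrix.mul_diagonal, Matrix.diagonal_mul]
  have e' : ∀ i j, B' i j = a' i * A i j * b' j := fun i j => by
    rw [hB', Matrix.mul_diagonal, Matrix.diagonal_mul]
  set u : Fin m → ℝ := fun i => Real.log (a' i / a i) with hu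
  set v : Fin n → ℝ := fun j => Real.log (b' j / b j) with hv
  have key : ∀ i j, B' i j = B i j * Real.exp (u i + v j) := by
    intro i j
    have h1 := (ha i).ne'
    have h2 := (hb j).ne'
    rw [e, e', Real.exp_add, Real.exp_log (div_pos (ha' i) (ha i)),
      Real.exp_log (div_pos (hb' j) (hb j))]
    field_simp
  have s0 : ∑ i, ∑ j, (B' i j - B i j) * (u i + v j) = 0 := by
    have h1 : ∑ i, ∑ j, (B' i j - B i j) * u i = 0 := by
      refine Finset.sum_eq_zero fun i _ => ?_
      rw [← Finset.sum_mul, Finset.sum_sub_distrib, hBr, hBr', sub_self, zero_mul]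
    have h2 : ∑ i, ∑ j, (B' i j - B i j) * v j = 0 := by
      rw [Finset.sum_comm]
      refine Finset.sum_eq_zero fun j _ => ?_
      rw [← Finset.sum_mul, Finset.sum_sub_distrib, hBc, hBc', sub_self, zero_mul]
    simp only [mul_add, Finset.sum_add_distrib, h1, h2, add_zero]
  have pos : ∀ x : ℝ, 0 ≤ (Real.exp x - 1) * x := by
    intro x
    rcases le_total 0 x with hx | hx
    · exact mul_nonneg (by linarith [Real.one_le_exp hx]) hx
    · exact mul_nonneg_of_nonpos_of_nonpos (by linarith [Real.exp_le_one_iff.2 hx]) hx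
  have t : ∀ i j, (B' i j - B i j) * (u i + v j)
      = B i j * ((Real.exp (u i + v j) - 1) * (u i + v j)) := by
    intro i j
    rw [key]
    ring
  have nn : ∀ i j, 0 ≤ (B' i j - B i j) * (u i + v j) := fun i j => by
    rw [t]
    exact mul_nonneg (hB0 i j) (pos _)
  ext i j
  have z1 := (Finset.sum_eq_zero_iff_of_nonneg
    (fun i _ => Finset.sum_nonneg fun j _ => nn i j)).1 s0 i (Finset.mem_univ i)
  have z2 := (Finset.sum_eq_zero_iff_of_nonneg (fun j _ => nn i j)).1 z1 j (Finset.mem_univ j)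
  rcases mul_eq_zero.1 z2 with h | h
  · linarith
  · rw [key, h, Real.exp_zero, mul_one]

/-- The entrywise `ℓ¹` norm of a matrix. -/
def l1Norm {m n : ℕ} (A : Matrix (Fin m) (Fin n) ℝ) : ℝ := ∑ i, ∑ j, |A i j|

/-- The smallest entry of a (nonempty) matrix. -/
def minEntry {m n : ℕ} (A : Matrix (Fin m) (Fin n) ℝ) : ℝ := ⨅ p : Fin m × Fin n, A p.1 p.2

/-- The largest entry of a (nonempty) matrix. -/
def maxEntry {m n : ℕ} (A : Matrix (Fin m) (Fin n) ℝ) : ℝ := ⨆ p : Fin m × Fin n, A p.1 p.2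

/-- A random matrix with independent nonnegative entries, positive mean matrix `L`, and centered
entries obeying the sub-exponential moment growth `E|X_ij - L_ij|^q ≤ (q!/2) σ² R^(q-2)` for all
integers `q ≥ 2`. -/
structure IsSubexponentialMatrix {Ω : Type*} [MeasurableSpace Ω] (μ : Measure Ω) {m n : ℕ}
    (X : Ω → Matrix (Fin m) (Fin n) ℝ) (L : Matrix (Fin m) (Fin n) ℝ) (σ R : ℝ) : Prop where
  aemeasurable : ∀ i j, AEMeasurable (fun ω => X ω i j) μ
  nonneg : ∀ i j, ∀ᵐ ω ∂μ, 0 ≤ X ω i j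
  indep : iIndepFun (fun (p : Fin m × Fin n) (ω : Ω) => X ω p.1 p.2) μ
  integrable : ∀ i j, Integrable (fun ω => X ω i j) μ
  mean : ∀ i j, ∫ ω, X ω i j ∂μ = L i j
  mean_pos : ∀ i j, 0 < L i j
  sigma_pos : 0 < σ
  scale_pos : 0 < R
  moment_integrable : ∀ i j, ∀ q : ℕ, 2 ≤ q → Integrable (fun ω => |X ω i j - L i j| ^ q) μ
  moment_le : ∀ i j, ∀ q : ℕ, 2 ≤ q →
    ∫ ω, |X ω i j - L i j| ^ q ∂μ ≤ (q.factorial : ℝ) / 2 * σ ^ 2 * R ^ (q - 2)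

/-- The bounded cost condition with constant `K ≥ 0`. -/
def BoundedCost {m n : ℕ} (r : Fin m → ℝ) (c : Fin n → ℝ) (L : Matrix (Fin m) (Fin n) ℝ)
    (K : ℝ) : Prop :=
  0 ≤ K ∧ ∀ i j, |Real.log (r i * c j * l1Norm L / (L i j * total r ^ 2))| ≤ K

/-- `τ = (D+1) log (m ∨ n) + log 4`. -/
def tau (m n : ℕ) (D : ℝ) : ℝ := (D + 1) * Real.log (max m n : ℕ) + Real.log 4

/-- The approximate scaling error `ε₀`. -/
def epsZero {m n : ℕ} (L : Matrix (Fin m) (Fin n) ℝ) (δ K σ R D : ℝ) : ℝ :=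
  Real.exp (2 * K) * (max m n : ℕ) / (δ * l1Norm L) *
    (σ * Real.sqrt (2 * (max m n : ℕ) * tau m n D) + 2 * R * tau m n D)

/-- The stability constant `C_*`. -/
def stabilityConst {m n : ℕ} (L : Matrix (Fin m) (Fin n) ℝ) (δ K : ℝ) : ℝ :=
  1 + 18 * Real.exp (8 * K) * l1Norm L ^ 2 / (δ ^ 2 * minEntry L ^ 2 * m ^ 2 * n ^ 2)

/-- The aggregate potential error `ε_pot = 16 C_* ε₀`. -/
def epsPot {m n : ℕ} (L : Matrix (Fin m) (Fin n) ℝ) (δ K σ R D : ℝ) : ℝ :=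
  16 * stabilityConst L δ K * epsZero L δ K σ R D

/-- The row-alignment rate `Φ`. -/
def rowAlignmentRate {m n : ℕ} (L : Matrix (Fin m) (Fin n) ℝ) (σ R : ℝ) : ℝ :=
  min (n * (minEntry L ^ 4 / (σ + R + maxEntry L) ^ 4))
    (Real.sqrt n * (minEntry L / (σ + R + maxEntry L)))

/-- The closed unit square. -/
def unitSquare : Set (ℝ × ℝ) := Set.Icc 0 1 ×ˢ Set.Icc 0 1

/-- The piecewise constant extension `(x, y) ↦ (mn/N) A(⌈mx⌉, ⌈ny⌉)` of a matrix to the unit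
square. The entry called `(k, l)` with `1 ≤ k ≤ m`, `1 ≤ l ≤ n` is the entry of `A` with
zero-based indices `(k - 1, l - 1)`; the value is `0` where an index is out of range, which on
the unit square happens only on the null set `{x = 0} ∪ {y = 0}`. -/
def stepDensity {m n : ℕ} (N : ℝ) (A : Matrix (Fin m) (Fin n) ℝ) (p : ℝ × ℝ) : ℝ :=
  (m * n : ℝ) / N * ∑ i : Fin m, ∑ j : Fin n,
    if ⌈(m : ℝ) * p.1⌉ = (i : ℤ) + 1 ∧ ⌈(n : ℝ) * p.2⌉ = (j : ℤ) + 1 then A i j else 0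

/-- The essential supremum norm of a test function on the unit square. -/
def supNorm (g : ℝ × ℝ → ℝ) : ℝ := (eLpNorm g ⊤ (volume.restrict unitSquare)).toReal

end MatrixScaling

end

/-! Let `a`, `b` be the scaling factors of the mean `L`, and put `Y i j = a i * X i j * b j`. The
proof compares the rescaling of `X` with `Y`, and `Y` with the rescaling of `L`.

Potentials: the bounded cost condition gives `exp (-(3 * K)) * N / S ≤ a i * b j ≤ exp (2 * K) * N /
S`, with `S = ‖L‖₁` (`scaling_factor_bounds`). The row sums, the column sums and the `g`-average of
`Y` minus the rescaled mean are therefore linear statistics of `X - L` with bounded weights.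
Bernstein's inequality makes `Y` have margins `(r, c)` up to a relative error `ε₀`.

Stability: a full Sinkhorn step acts on row potentials and commutes with adding constants. Its
derivative is a stochastic matrix, the two-step kernel row → column → row, whose entries are
comparable to the normalized Gram matrix of the rows of `Y`. If that Gram matrix is at least `η / m`
entrywise, Doeblin's argument makes the step contract oscillation by about `1 - η` on a small ball.
Since the step moves the zero potential by `O(ε₀)`, it preserves a ball of radius `O(ε₀ / η)` and
has there a fixed point modulo constants (`exists_scaling_of_approx`). So `X` is scalable, and its
rescaling is `Y i j * exp (u i + v j)` with `|u i + v j| ≤ ε_pot`, hence `ℓ¹`-close to `Y`.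

Row alignment: for two distinct rows the inner product is a sum of independent nonnegative
variables, and a second-moment Chernoff bound controls its lower tail (`measureReal_row_inner_le`).
On the diagonal Cauchy–Schwarz suffices. A union bound finishes the proof. -/

noncomputable section

namespace MatrixScaling

/-! ### Sinkhorn iteration on potentials, its derivative, and fixed points. -/

section Sinkhorn

variable {ι κ : Type*} [Fintype κ]

/-- The logarithmic potential which, given column potentials `v`, corrects the row sums of
`Y i j * exp (v j)` to `r`. -/
def logScale (Y : ι → κ → ℝ) (r : ι → ℝ) (v : κ → ℝ) (i : ι) : ℝ :=
  Real.log (r i) - Real.log (∑ j, Y i j * Real.exp (v j))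

/-- The Gibbs kernel `Y i j exp (v j) / ∑ l, Y i l exp (v l)`. -/
def gibbs (Y : ι → κ → ℝ) (v : κ → ℝ) (i : ι) (j : κ) : ℝ :=
  Y i j * Real.exp (v j) / ∑ l, Y i l * Real.exp (v l)

theorem sum_mul_exp_pos {Y : ι → κ → ℝ} (hY : ∀ i j, 0 ≤ Y i j) {i : ι} (h : ∃ j, 0 < Y i j)
    (v : κ → ℝ) : 0 < ∑ j, Y i j * Real.exp (v j) := by
  obtain ⟨j, hj⟩ := h
  exact Finset.sum_pos' (fun l _ => mul_nonneg (hY i l) (Real.exp_pos _).le)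
    ⟨j, Finset.mem_univ j, mul_pos hj (Real.exp_pos _)⟩

theorem exp_logScale {Y : ι → κ → ℝ} (hY : ∀ i j, 0 ≤ Y i j) {r : ι → ℝ} {i : ι} (hr : 0 < r i)
    (h : ∃ j, 0 < Y i j) (v : κ → ℝ) :
    Real.exp (logScale Y r v i) = r i / ∑ j, Y i j * Real.exp (v j) := by
  rw [logScale, Real.exp_sub, Real.exp_log hr, Real.exp_log (sum_mul_exp_pos hY h v)]

theorem sum_mul_exp_logScale {Y : ι → κ → ℝ} (hY : ∀ i j, 0 ≤ Y i j) {r : ι → ℝ} {i : ι}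
    (hr : 0 < r i) (h : ∃ j, 0 < Y i j) (v : κ → ℝ) :
    ∑ j, Y i j * Real.exp (logScale Y r v i + v j) = r i := by
  simp_rw [Real.exp_add, mul_left_comm (Y i _)]
  rw [← Finset.mul_sum, exp_logScale hY hr h, div_mul_cancel₀ _ (sum_mul_exp_pos hY h v).ne']

theorem logScale_add_const {Y : ι → κ → ℝ} (hY : ∀ i j, 0 ≤ Y i j) {i : ι}
    (h : ∃ j, 0 < Y i j) (r : ι → ℝ) (v : κ → ℝ) (t : ℝ) :
    logScale Y r (fun j => v j + t) i = logScale Y r v i - t := by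
  simp_rw [logScale, Real.exp_add, ← mul_assoc]
  rw [← Finset.sum_mul, Real.log_mul (sum_mul_exp_pos hY h v).ne' (Real.exp_pos _).ne',
    Real.log_exp]
  ring

theorem continuous_logScale {Y : ι → κ → ℝ} (hY : ∀ i j, 0 ≤ Y i j) (h : ∀ i, ∃ j, 0 < Y i j)
    (r : ι → ℝ) : Continuous (logScale Y r) := by
  refine continuous_pi fun i => continuous_const.sub (Continuous.log (by fun_prop) fun v => ?_)
  exact (sum_mul_exp_pos hY (h i) v).ne'

theorem hasDerivAt_logScale {Y : ι → κ → ℝ} (hY : ∀ i j, 0 ≤ Y i j) {i : ι}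
    (h : ∃ j, 0 < Y i j) (r : ι → ℝ) {v : ℝ → κ → ℝ} {v' : κ → ℝ} {t : ℝ}
    (hv : ∀ j, HasDerivAt (fun s => v s j) (v' j) t) :
    HasDerivAt (fun s => logScale Y r (v s) i) (-∑ j, gibbs Y (v t) i j * v' j) t := by
  have h1 : HasDerivAt (fun s => ∑ j, Y i j * Real.exp (v s j))
      (∑ j, Y i j * (Real.exp (v t j) * v' j)) t :=
    HasDerivAt.fun_sum fun j _ => ((hv j).exp).const_mul _
  have h2 := (h1.log (sum_mul_exp_pos hY h (v t)).ne').const_sub (Real.log (r i))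
  refine h2.congr_deriv ?_
  rw [Finset.sum_div]
  congr 1
  refine Finset.sum_congr rfl fun j _ => ?_
  rw [gibbs]
  ring

theorem sum_gibbs {Y : ι → κ → ℝ} (hY : ∀ i j, 0 ≤ Y i j) {i : ι} (h : ∃ j, 0 < Y i j)
    (v : κ → ℝ) : ∑ j, gibbs Y v i j = 1 := by
  simp_rw [gibbs]
  rw [← Finset.sum_div, div_self (sum_mul_exp_pos hY h v).ne']

theorem gibbs_nonneg {Y : ι → κ → ℝ} (hY : ∀ i j, 0 ≤ Y i j) (v : κ → ℝ) (i : ι) (j : κ) :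
    0 ≤ gibbs Y v i j :=
  div_nonneg (mul_nonneg (hY i j) (Real.exp_pos _).le)
    (Finset.sum_nonneg fun l _ => mul_nonneg (hY i l) (Real.exp_pos _).le)

variable [Fintype ι]

/-- One full Sinkhorn step on the row potentials. -/
def sinkhornStep (Y : ι → κ → ℝ) (r : ι → ℝ) (c : κ → ℝ) (u : ι → ℝ) : ι → ℝ :=
  logScale Y r (logScale (fun j i => Y i j) c u)

/-- The two-step kernel, which is the derivative of the Sinkhorn step. -/
def sinkhornKernel (Y : ι → κ → ℝ) (c : κ → ℝ) (u : ι → ℝ) (i k : ι) : ℝ :=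
  ∑ j, gibbs Y (logScale (fun j i => Y i j) c u) i j * gibbs (fun j i => Y i j) u j k

/-- Each half-step differentiates to minus a Gibbs average; the two signs cancel, so the full step
has a nonnegative kernel as derivative. -/
theorem hasDerivAt_sinkhornStep {Y : ι → κ → ℝ} (hY : ∀ i j, 0 ≤ Y i j)
    (hrow : ∀ i, ∃ j, 0 < Y i j) (hcol : ∀ j, ∃ i, 0 < Y i j) (r : ι → ℝ) (c : κ → ℝ)
    (w h : ι → ℝ) (i : ι) (t : ℝ) :
    HasDerivAt (fun s : ℝ => sinkhornStep Y r c (fun k => w k + s * h k) i)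
      (∑ k, sinkhornKernel Y c (fun k => w k + t * h k) i k * h k) t := by
  have h1 : ∀ j, HasDerivAt
      (fun s : ℝ => logScale (fun j i => Y i j) c (fun k => w k + s * h k) j)
      (-∑ k, gibbs (fun j i => Y i j) (fun k => w k + t * h k) j k * h k) t := fun j =>
    hasDerivAt_logScale (v := fun s k => w k + s * h k) (fun j i => hY i j) (hcol j) c fun k => by
      simpa using ((hasDerivAt_id t).mul_const (h k)).const_add (w k)
  refine (hasDerivAt_logScale hY (hrow i) r h1).congr_deriv ?_
  simp_rw [sinkhornKernel, Finset.sum_mul, mul_neg, Finset.sum_neg_distrib, neg_neg,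
    Finset.mul_sum]
  rw [Finset.sum_comm]
  simp_rw [mul_assoc]

theorem sum_sinkhornKernel {Y : ι → κ → ℝ} (hY : ∀ i j, 0 ≤ Y i j)
    (hrow : ∀ i, ∃ j, 0 < Y i j) (hcol : ∀ j, ∃ i, 0 < Y i j) (c : κ → ℝ) (u : ι → ℝ) (i : ι) :
    ∑ k, sinkhornKernel Y c u i k = 1 := by
  simp_rw [sinkhornKernel]
  rw [Finset.sum_comm]
  simp_rw [← Finset.mul_sum, sum_gibbs (fun j i => hY i j) (hcol _), mul_one,
    sum_gibbs hY (hrow i)]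

theorem sinkhornKernel_pos {Y : ι → κ → ℝ} (hY : ∀ i j, 0 ≤ Y i j) (c : κ → ℝ) (u : ι → ℝ)
    {i k : ι} (h : ∃ j, 0 < Y i j ∧ 0 < Y k j) : 0 < sinkhornKernel Y c u i k := by
  obtain ⟨j, h1, h2⟩ := h
  refine Finset.sum_pos' (fun l _ => mul_nonneg (gibbs_nonneg hY _ _ _)
    (gibbs_nonneg (fun j i => hY i j) _ _ _)) ⟨j, Finset.mem_univ j, mul_pos ?_ ?_⟩
  · exact div_pos (mul_pos h1 (Real.exp_pos _)) (sum_mul_exp_pos hY ⟨j, h1⟩ _)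
  · exact div_pos (mul_pos h2 (Real.exp_pos _))
      (sum_mul_exp_pos (Y := fun j i => Y i j) (fun j i => hY i j) ⟨k, h2⟩ _)

/-- Doeblin's contraction estimate. -/
theorem sum_sub_mul_le_of_minorized {p q h : ι → ℝ} {θ lo hi : ℝ} (hp : ∑ k, p k = 1)
    (hq : ∑ k, q k = 1) (hpθ : ∀ k, θ ≤ p k) (hqθ : ∀ k, θ ≤ q k) (hlo : ∀ k, lo ≤ h k)
    (hhi : ∀ k, h k ≤ hi) :
    ∑ k, p k * h k - ∑ k, q k * h k ≤ (1 - Fintype.card ι * θ) * (hi - lo) := by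
  -- Removing the common part `θ` leaves nonnegative weights of mass `1 - card ι * θ`, and `θ * ∑ h`
  -- cancels in the difference.
  have h1 : ∑ k, (p k - θ) * h k ≤ ∑ k, (p k - θ) * hi :=
    Finset.sum_le_sum fun k _ => mul_le_mul_of_nonneg_left (hhi k) (sub_nonneg.2 (hpθ k))
  have h2 : ∑ k, (q k - θ) * lo ≤ ∑ k, (q k - θ) * h k :=
    Finset.sum_le_sum fun k _ => mul_le_mul_of_nonneg_left (hlo k) (sub_nonneg.2 (hqθ k))
  simp only [sub_mul, Finset.sum_sub_distrib, ← Finset.sum_mul, hp, hq, Finset.sum_const,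
    Finset.card_univ, nsmul_eq_mul] at h1 h2
  linarith

/-- The mean value theorem is applied to the difference of two coordinates, so that both kernel rows
are taken at the same intermediate potential and can be compared by Doeblin's estimate. -/
theorem exists_sinkhornStep_sub_eq {Y : ι → κ → ℝ} (hY : ∀ i j, 0 ≤ Y i j)
    (hrow : ∀ i, ∃ j, 0 < Y i j) (hcol : ∀ j, ∃ i, 0 < Y i j) (r : ι → ℝ) (c : κ → ℝ)
    (u w : ι → ℝ) (i l : ι) : ∃ s ∈ Set.Ioo (0 : ℝ) 1,
      (sinkhornStep Y r c u i - sinkhornStep Y r c w i)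
        - (sinkhornStep Y r c u l - sinkhornStep Y r c w l)
      = ∑ k, sinkhornKernel Y c (fun k => w k + s * (u k - w k)) i k * (u k - w k)
        - ∑ k, sinkhornKernel Y c (fun k => w k + s * (u k - w k)) l k * (u k - w k) := by
  have hd := fun t => (hasDerivAt_sinkhornStep hY hrow hcol r c w (fun k => u k - w k) i t).sub
    (hasDerivAt_sinkhornStep hY hrow hcol r c w (fun k => u k - w k) l t)
  obtain ⟨s, hs, h⟩ := exists_hasDerivAt_eq_slope _ _ zero_lt_one
    (fun t _ => (hd t).continuousAt.continuousWithinAt) fun t _ => hd t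
  refine ⟨s, hs, ?_⟩
  rw [h]
  simp
  ring

theorem sinkhornStep_add_const {Y : ι → κ → ℝ} (hY : ∀ i j, 0 ≤ Y i j)
    (hrow : ∀ i, ∃ j, 0 < Y i j) (hcol : ∀ j, ∃ i, 0 < Y i j) (r : ι → ℝ) (c : κ → ℝ)
    (u : ι → ℝ) (t : ℝ) (i : ι) :
    sinkhornStep Y r c (fun k => u k + t) i = sinkhornStep Y r c u i + t := by
  have h : logScale (fun j i => Y i j) c (fun k => u k + t)
      = fun j => logScale (fun j i => Y i j) c u j + (-t) := by
    funext j
    rw [logScale_add_const (fun j i => hY i j) (hcol j)]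
    ring
  rw [sinkhornStep, h, logScale_add_const hY (hrow i), sinkhornStep]
  ring

variable [Nonempty ι]

/-- The oscillation of a real function on a finite type. -/
def osc (h : ι → ℝ) : ℝ :=
  (Finset.univ : Finset (ι × ι)).sup' Finset.univ_nonempty fun p => h p.1 - h p.2

theorem sub_le_osc (h : ι → ℝ) (i k : ι) : h i - h k ≤ osc h :=
  Finset.le_sup' (fun p : ι × ι => h p.1 - h p.2) (Finset.mem_univ (i, k))

theorem osc_le {h : ι → ℝ} {B : ℝ} (hB : ∀ i k, h i - h k ≤ B) : osc h ≤ B :=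
  Finset.sup'_le _ _ fun p _ => hB p.1 p.2

theorem exists_eq_osc (h : ι → ℝ) : ∃ i k, osc h = h i - h k := by
  obtain ⟨p, -, hp⟩ := Finset.exists_mem_eq_sup' (Finset.univ_nonempty (α := ι × ι))
    fun p : ι × ι => h p.1 - h p.2
  exact ⟨p.1, p.2, hp⟩

theorem osc_nonneg (h : ι → ℝ) : 0 ≤ osc h := by
  simpa using sub_le_osc h (Classical.arbitrary ι) (Classical.arbitrary ι)

theorem continuous_osc : Continuous (osc : (ι → ℝ) → ℝ) :=
  Continuous.finset_sup'_apply _ fun p _ => by fun_prop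

/-- A common neighbour for every pair of rows makes all entries of the kernel positive, so their
minimum is an admissible Doeblin constant. It depends on the intermediate potential, so only strict
decrease results, not a uniform contraction. -/
theorem osc_sinkhornStep_sub_lt {Y : ι → κ → ℝ} (hY : ∀ i j, 0 ≤ Y i j)
    (hcol : ∀ j, ∃ i, 0 < Y i j) (hgram : ∀ i k, ∃ j, 0 < Y i j ∧ 0 < Y k j)
    (r : ι → ℝ) (c : κ → ℝ) (u w : ι → ℝ) (hpos : 0 < osc (fun k => u k - w k)) :
    osc (fun i => sinkhornStep Y r c u i - sinkhornStep Y r c w i)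
      < osc (fun k => u k - w k) := by
  have hrow : ∀ i, ∃ j, 0 < Y i j := fun i => (hgram i i).imp fun j h => h.1
  obtain ⟨i, l, hil⟩ := exists_eq_osc fun i => sinkhornStep Y r c u i - sinkhornStep Y r c w i
  obtain ⟨s, -, hs⟩ := exists_sinkhornStep_sub_eq hY hrow hcol r c u w i l
  rw [hil, hs]
  set z : ι → ℝ := fun k => w k + s * (u k - w k)
  obtain ⟨p, hp⟩ := Finite.exists_min fun p : ι × ι => sinkhornKernel Y c z p.1 p.2
  have hθ : 0 < sinkhornKernel Y c z p.1 p.2 := sinkhornKernel_pos hY c z (hgram _ _)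
  obtain ⟨hi, hhi⟩ := Finite.exists_max fun k => u k - w k
  obtain ⟨lo, hlo⟩ := Finite.exists_min fun k => u k - w k
  have h1 := sum_sub_mul_le_of_minorized (sum_sinkhornKernel hY hrow hcol c z i)
    (sum_sinkhornKernel hY hrow hcol c z l) (fun k => hp (i, k)) (fun k => hp (l, k)) hlo hhi
  have h2 := sub_le_osc (fun k => u k - w k) hi lo
  have h3 : (0 : ℝ) < Fintype.card ι := Nat.cast_pos.2 Fintype.card_pos
  have h4 := osc_le (h := fun k => u k - w k) fun i k => sub_le_sub (hhi i) (hlo k)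
  have h5 := mul_pos (mul_pos h3 hθ) hpos
  have h6 : osc (fun k => u k - w k) = u hi - w hi - (u lo - w lo) := le_antisymm h4 h2
  rw [← h6] at h1
  linarith

/-- Edelstein's argument: the displacement oscillation attains its minimum by compactness, and a
positive minimum would be strictly lowered by one more step. -/
theorem exists_sinkhornStep_sub_const {Y : ι → κ → ℝ} (hY : ∀ i j, 0 ≤ Y i j)
    (hcol : ∀ j, ∃ i, 0 < Y i j) (hgram : ∀ i k, ∃ j, 0 < Y i j ∧ 0 < Y k j)
    (r : ι → ℝ) (c : κ → ℝ) {B : ℝ} (hB : 0 ≤ B)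
    (hmap : ∀ u, osc u ≤ B → osc (sinkhornStep Y r c u) ≤ B) :
    ∃ u, osc u ≤ B ∧ osc (fun i => sinkhornStep Y r c u i - u i) = 0 := by
  have hrow : ∀ i, ∃ j, 0 < Y i j := fun i => (hgram i i).imp fun j h => h.1
  set i₀ := Classical.arbitrary ι
  -- Oscillation ignores constants; pinning one coordinate to zero restores compactness.
  set S : Set (ι → ℝ) := {u | osc u ≤ B ∧ u i₀ = 0}
  have hS : IsCompact S := by
    refine (isCompact_Icc (a := fun _ : ι => -B) (b := fun _ => B)).of_isClosed_subset ?_ ?_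
    · exact (isClosed_le continuous_osc continuous_const).inter
        (isClosed_eq (continuous_apply i₀) continuous_const)
    · rintro u ⟨h1, h2⟩
      refine ⟨fun i => ?_, fun i => ?_⟩
      · have := (sub_le_osc u i₀ i).trans h1
        show -B ≤ u i
        linarith
      · have := (sub_le_osc u i i₀).trans h1
        show u i ≤ B
        linarith
  have hne : S.Nonempty := ⟨fun _ => 0, osc_le fun _ _ => by simpa using hB, rfl⟩
  have hcont : Continuous fun u : ι → ℝ => osc fun i => sinkhornStep Y r c u i - u i := by
    refine continuous_osc.comp (continuous_pi fun i => ?_)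
    exact ((continuous_apply i).comp ((continuous_logScale hY hrow r).comp
      (continuous_logScale (fun j i => hY i j) hcol c))).sub (continuous_apply i)
  obtain ⟨u, hu, hmin⟩ := hS.exists_isMinOn hne hcont.continuousOn
  refine ⟨u, hu.1, ?_⟩
  by_contra hne0
  have hpos := lt_of_le_of_ne (osc_nonneg _) (Ne.symm hne0)
  set w := sinkhornStep Y r c u with hw
  have hlt := osc_sinkhornStep_sub_lt hY hcol hgram r c w u hpos
  have hmem : (fun i => w i + (-w i₀)) ∈ S := by
    refine ⟨osc_le fun i k => ?_, add_neg_cancel _⟩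
    have := (sub_le_osc w i k).trans (hmap u hu.1)
    linarith
  have hle := hmin hmem
  simp only [Set.mem_ofPred_eq, sinkhornStep_add_const hY hrow hcol, add_sub_add_right_eq_sub]
    at hle
  exact absurd hlt (not_lt.2 hle)

/-- If the Sinkhorn step preserves a set of potentials of bounded oscillation, then it has a
fixed point there, and the corresponding rescaling has the prescribed margins. -/
theorem exists_scaling_of_mapsTo {Y : ι → κ → ℝ} (hY : ∀ i j, 0 ≤ Y i j)
    (hcol : ∀ j, ∃ i, 0 < Y i j) (hgram : ∀ i k, ∃ j, 0 < Y i j ∧ 0 < Y k j)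
    {r : ι → ℝ} {c : κ → ℝ} (hr : ∀ i, 0 < r i) (hc : ∀ j, 0 < c j)
    (hrc : ∑ i, r i = ∑ j, c j) {B : ℝ} (hB : 0 ≤ B)
    (hmap : ∀ u, osc u ≤ B → osc (sinkhornStep Y r c u) ≤ B) :
    ∃ u, osc u ≤ B ∧
      (∀ i, ∑ j, Y i j * Real.exp (u i + logScale (fun j i => Y i j) c u j) = r i) ∧
      (∀ j, ∑ i, Y i j * Real.exp (u i + logScale (fun j i => Y i j) c u j) = c j) := by
  have hrow : ∀ i, ∃ j, 0 < Y i j := fun i => (hgram i i).imp fun j h => h.1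
  obtain ⟨u, hu, hosc⟩ := exists_sinkhornStep_sub_const hY hcol hgram r c hB hmap
  set v := logScale (fun j i => Y i j) c u with hv
  have hcols : ∀ j, ∑ i, Y i j * Real.exp (u i + v j) = c j := fun j => by
    have := sum_mul_exp_logScale (Y := fun j i => Y i j) (fun j i => hY i j) (hc j) (hcol j) u
    simpa only [add_comm] using this
  set t := sinkhornStep Y r c u (Classical.arbitrary ι) - u (Classical.arbitrary ι)
  have ht : ∀ i, sinkhornStep Y r c u i = u i + t := fun i => by
    have h1 := sub_le_osc (fun i => sinkhornStep Y r c u i - u i) i (Classical.arbitrary ι)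
    have h2 := sub_le_osc (fun i => sinkhornStep Y r c u i - u i) (Classical.arbitrary ι) i
    rw [hosc] at h1 h2
    simp only [t]
    linarith
  have hrows : ∀ i, (∑ j, Y i j * Real.exp (u i + v j)) * Real.exp t = r i := fun i => by
    rw [← sum_mul_exp_logScale hY (hr i) (hrow i) v, Finset.sum_mul]
    refine Finset.sum_congr rfl fun j _ => ?_
    have : logScale Y r v i = u i + t := ht i
    rw [this, mul_assoc, ← Real.exp_add]
    ring_nf
  have hpos : 0 < ∑ i, r i := Finset.sum_pos (fun i _ => hr i) Finset.univ_nonempty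
  -- A fixed point modulo constants has exact column sums and row sums `r i * exp (-t)`; equality of
  -- the two totals forces `t = 0`.
  have hsum : (∑ j, c j) * Real.exp t = ∑ j, c j := by
    conv_rhs => rw [← hrc]
    rw [← Finset.sum_congr rfl fun i _ => hrows i, ← Finset.sum_mul, Finset.sum_comm,
      Finset.sum_congr rfl fun j _ => hcols j]
  have het : Real.exp t = 1 := by
    rw [hrc] at hpos
    exact mul_left_cancel₀ hpos.ne' (hsum.trans (mul_one _).symm)
  exact ⟨u, hu, fun i => by rw [← hrows i, het, mul_one], hcols⟩

/-- Every positive matrix can be rescaled to any positive margin. -/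
theorem exists_scaling_of_pos [Nonempty κ] {Y : ι → κ → ℝ} (hY : ∀ i j, 0 < Y i j)
    {r : ι → ℝ} {c : κ → ℝ} (hr : ∀ i, 0 < r i) (hc : ∀ j, 0 < c j)
    (hrc : ∑ i, r i = ∑ j, c j) :
    ∃ (u : ι → ℝ) (v : κ → ℝ), (∀ i, ∑ j, Y i j * Real.exp (u i + v j) = r i) ∧
      (∀ j, ∑ i, Y i j * Real.exp (u i + v j) = c j) := by
  have hY' : ∀ i j, 0 ≤ Y i j := fun i j => (hY i j).le
  set f : ι × ι × κ → ℝ := fun p => Real.log (r p.1 * Y p.2.1 p.2.2 / (r p.2.1 * Y p.1 p.2.2))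
  set B := ∑ p, |f p|
  -- This bound on ratios of entries controls the oscillation of the output of a step whatever the
  -- input, so the ball of radius `B` is trivially preserved.
  have hB : ∀ i k j, r i * Y k j ≤ Real.exp B * (r k * Y i j) := fun i k j => by
    have h1 : 0 < r k * Y i j := mul_pos (hr k) (hY i j)
    rw [← div_le_iff₀ h1, ← Real.log_le_iff_le_exp (div_pos (mul_pos (hr i) (hY k j)) h1)]
    exact (le_abs_self _).trans (Finset.single_le_sum (f := fun p => |f p|)
      (fun p _ => abs_nonneg _) (Finset.mem_univ (i, k, j)))
  obtain ⟨u, -, h1, h2⟩ := exists_scaling_of_mapsTo hY'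
    (fun j => ⟨Classical.arbitrary ι, hY _ j⟩)
    (fun i k => ⟨Classical.arbitrary κ, hY _ _, hY _ _⟩) hr hc hrc
    (Finset.sum_nonneg fun p _ => abs_nonneg (f p)) fun u _ => osc_le fun i k => by
      set v := logScale (fun j i => Y i j) c u
      have e := fun i => exp_logScale hY' (hr i) ⟨Classical.arbitrary κ, hY i _⟩ v
      have s := fun i => sum_mul_exp_pos hY' (i := i) ⟨Classical.arbitrary κ, hY i _⟩ v
      rw [← Real.exp_le_exp, Real.exp_sub]
      show Real.exp (logScale Y r v i) / Real.exp (logScale Y r v k) ≤ _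
      rw [e, e, div_div_div_eq, div_le_iff₀ (mul_pos (s i) (hr k)), Finset.mul_sum,
        Finset.sum_mul, Finset.mul_sum]
      refine Finset.sum_le_sum fun j _ => ?_
      nlinarith [mul_le_mul_of_nonneg_right (hB i k j) (Real.exp_pos (v j)).le]
  exact ⟨u, _, h1, h2⟩

end Sinkhorn

/-! ### Quantitative stability of scaling under approximate margins. -/

section ApproximateScaling

theorem sum_mul_exp_le {κ : Type*} [Fintype κ] {y v : κ → ℝ} {s ε M : ℝ} (hy : ∀ j, 0 ≤ y j)
    (hs : |∑ j, y j - s| ≤ ε * s) (hM : ∀ j, Real.exp (v j) ≤ M) (hM0 : 0 ≤ M) :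
    ∑ j, y j * Real.exp (v j) ≤ (1 + ε) * s * M := by
  calc ∑ j, y j * Real.exp (v j) ≤ ∑ j, y j * M :=
        Finset.sum_le_sum fun j _ => mul_le_mul_of_nonneg_left (hM j) (hy j)
    _ = (∑ j, y j) * M := (Finset.sum_mul _ _ _).symm
    _ ≤ _ := mul_le_mul_of_nonneg_right (by linarith [(abs_le.1 hs).2]) hM0

theorem le_sum_mul_exp {κ : Type*} [Fintype κ] {y v : κ → ℝ} {s ε M : ℝ} (hy : ∀ j, 0 ≤ y j)
    (hs : |∑ j, y j - s| ≤ ε * s) (hM : ∀ j, M ≤ Real.exp (v j)) (hM0 : 0 ≤ M) :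
    (1 - ε) * s * M ≤ ∑ j, y j * Real.exp (v j) := by
  calc (1 - ε) * s * M ≤ (∑ j, y j) * M :=
        mul_le_mul_of_nonneg_right (by linarith [(abs_le.1 hs).1]) hM0
    _ = ∑ j, y j * M := Finset.sum_mul _ _ _
    _ ≤ _ := Finset.sum_le_sum fun j _ => mul_le_mul_of_nonneg_left (hM j) (hy j)

theorem exists_pos_of_abs_sum_sub_le {κ : Type*} [Fintype κ] {y : κ → ℝ} {s ε : ℝ}
    (hs0 : 0 < s) (hε : ε < 1) (hs : |∑ j, y j - s| ≤ ε * s) : ∃ j, 0 < y j := by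
  have h : 0 < ∑ j, y j := by nlinarith [(abs_le.1 hs).1]
  obtain ⟨j, -, hj⟩ := Finset.exists_lt_of_sum_lt (s := Finset.univ) (f := fun _ => (0 : ℝ)) (by simpa using h)
  exact ⟨j, hj⟩

variable {ι κ : Type*} [Fintype κ]

theorem exp_logScale_le {Y : ι → κ → ℝ} {r : ι → ℝ} {v : κ → ℝ} {ε M : ℝ} {i : ι}
    (hY : ∀ i j, 0 ≤ Y i j) (hr : 0 < r i) (hε1 : ε < 1)
    (hrow : |∑ j, Y i j - r i| ≤ ε * r i) (hM : ∀ j, M ≤ Real.exp (v j)) (hM0 : 0 < M) :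
    Real.exp (logScale Y r v i) ≤ 1 / ((1 - ε) * M) := by
  have h1 := exists_pos_of_abs_sum_sub_le hr hε1 hrow
  have h2 : 0 < 1 - ε := by linarith
  rw [exp_logScale hY hr h1, div_le_div_iff₀ (sum_mul_exp_pos hY h1 v) (by positivity)]
  linarith [le_sum_mul_exp (hY i) hrow hM hM0.le]

theorem le_exp_logScale {Y : ι → κ → ℝ} {r : ι → ℝ} {v : κ → ℝ} {ε M : ℝ} {i : ι}
    (hY : ∀ i j, 0 ≤ Y i j) (hr : 0 < r i) (hε0 : 0 ≤ ε) (hε1 : ε < 1)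
    (hrow : |∑ j, Y i j - r i| ≤ ε * r i) (hM : ∀ j, Real.exp (v j) ≤ M) (hM0 : 0 < M) :
    1 / ((1 + ε) * M) ≤ Real.exp (logScale Y r v i) := by
  have h1 := exists_pos_of_abs_sum_sub_le hr hε1 hrow
  rw [exp_logScale hY hr h1, div_le_div_iff₀ (by positivity) (sum_mul_exp_pos hY h1 v)]
  linarith [sum_mul_exp_le (hY i) hrow hM hM0.le]

theorem le_gibbs {Y : ι → κ → ℝ} {r : ι → ℝ} {v : κ → ℝ} {ε lo hi : ℝ} {i : ι}
    (hY : ∀ i j, 0 ≤ Y i j) (hr : 0 < r i) (hε0 : 0 ≤ ε) (hε1 : ε < 1)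
    (hrow : |∑ j, Y i j - r i| ≤ ε * r i) (hlo0 : 0 < lo) (hlo : ∀ j, lo ≤ Real.exp (v j))
    (hhi : ∀ j, Real.exp (v j) ≤ hi) (j : κ) :
    lo / hi / (1 + ε) * (Y i j / r i) ≤ gibbs Y v i j := by
  have h1 := exists_pos_of_abs_sum_sub_le hr hε1 hrow
  have hhi0 : 0 < hi := (Real.exp_pos _).trans_le (hhi j)
  rw [gibbs, show lo / hi / (1 + ε) * (Y i j / r i) = Y i j * lo / ((1 + ε) * r i * hi) by
    field_simp]
  exact div_le_div₀ (mul_nonneg (hY i j) (Real.exp_pos _).le)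
    (mul_le_mul_of_nonneg_left (hlo j) (hY i j)) (sum_mul_exp_pos hY h1 v)
    (sum_mul_exp_le (hY i) hrow hhi hhi0.le)

variable [Fintype ι] [Nonempty ι]

/-- With exact margins and zero potentials the kernel is this Gram sum. Each of the two Gibbs
factors loses `exp (-B)` through the oscillation of the potentials, and the approximate margins cost
the factors in `ε`. -/
theorem le_sinkhornKernel {Y : ι → κ → ℝ} {r : ι → ℝ} {c : κ → ℝ} {ε η B : ℝ}
    (hY : ∀ i j, 0 ≤ Y i j) (hr : ∀ i, 0 < r i) (hc : ∀ j, 0 < c j) (hε0 : 0 ≤ ε) (hε1 : ε < 1)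
    (hrow : ∀ i, |∑ j, Y i j - r i| ≤ ε * r i) (hcol : ∀ j, |∑ i, Y i j - c j| ≤ ε * c j)
    {i k : ι} (hgram : η ≤ ∑ j, Y i j * Y k j / (r i * c j)) {u : ι → ℝ} (hu : osc u ≤ B) :
    Real.exp (-(2 * B)) * (1 - ε) / (1 + ε) ^ 3 * η ≤ sinkhornKernel Y c u i k := by
  obtain ⟨hi, hhi⟩ := Finite.exists_max u
  obtain ⟨lo, hlo⟩ := Finite.exists_min u
  have hB : Real.exp (-B) ≤ Real.exp (u lo) / Real.exp (u hi) := by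
    rw [← Real.exp_sub, Real.exp_le_exp]
    linarith [sub_le_osc u hi lo]
  have hε : 0 < 1 - ε := by linarith
  have g1 := fun j => le_gibbs (Y := fun j i => Y i j) (fun j i => hY i j) (hc j) hε0 hε1 (hcol j)
    (Real.exp_pos (u lo)) (fun k => Real.exp_le_exp.2 (hlo k))
    (fun k => Real.exp_le_exp.2 (hhi k)) k
  have g2 := le_gibbs hY (hr i) hε0 hε1 (hrow i) (v := logScale (fun j i => Y i j) c u)
    (lo := 1 / ((1 + ε) * Real.exp (u hi))) (hi := 1 / ((1 - ε) * Real.exp (u lo)))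
    (by positivity)
    (fun j => le_exp_logScale (fun j i => hY i j) (hc j) hε0 hε1 (hcol j)
      (fun k => Real.exp_le_exp.2 (hhi k)) (Real.exp_pos _))
    (fun j => exp_logScale_le (fun j i => hY i j) (hc j) hε1 (hcol j)
      (fun k => Real.exp_le_exp.2 (hlo k)) (Real.exp_pos _))
  refine (mul_le_mul_of_nonneg_left hgram (by positivity)).trans ?_
  rw [Finset.mul_sum]
  refine Finset.sum_le_sum fun j _ => ?_
  have f1 : Real.exp (-B) / (1 + ε) * (Y k j / c j) ≤ gibbs (fun j i => Y i j) u j k := by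
    refine le_trans ?_ (g1 j)
    have := div_nonneg (hY k j) (hc j).le
    gcongr
  have f2 : Real.exp (-B) * (1 - ε) / (1 + ε) ^ 2 * (Y i j / r i)
      ≤ gibbs Y (logScale (fun j i => Y i j) c u) i j := by
    refine le_trans (mul_le_mul_of_nonneg_right ?_ (div_nonneg (hY i j) (hr i).le)) (g2 j)
    rw [show 1 / ((1 + ε) * Real.exp (u hi)) / (1 / ((1 - ε) * Real.exp (u lo))) / (1 + ε)
      = Real.exp (u lo) / Real.exp (u hi) * (1 - ε) / (1 + ε) ^ 2 by field_simp]
    gcongr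
  have h0 : 0 ≤ Real.exp (-B) / (1 + ε) * (Y k j / c j) := by
    have := div_nonneg (hY k j) (hc j).le
    positivity
  refine le_of_eq_of_le ?_ (mul_le_mul f2 f1 h0 (gibbs_nonneg hY _ _ _))
  have hri := (hr i).ne'
  have hcj := (hc j).ne'
  rw [show -(2 * B) = -B + -B by ring, Real.exp_add]
  field_simp

theorem inv_one_sub_le_exp {ε : ℝ} (hε0 : 0 ≤ ε) (hε : ε ≤ 1 / 160) :
    1 / (1 - ε) ≤ Real.exp (3 / 2 * ε) := by
  have h := Real.add_one_le_exp (3 / 2 * ε)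
  rw [div_le_iff₀ (by linarith)]
  nlinarith

/-- From zero potentials the ratio of two outputs is at most `((1 + ε) / (1 - ε)) ^ 2`; the exponent
is `2 * (3 / 2) + 2 = 5` times `ε`. -/
theorem osc_sinkhornStep_zero_le {Y : ι → κ → ℝ} {r : ι → ℝ} {c : κ → ℝ} {ε : ℝ}
    (hY : ∀ i j, 0 ≤ Y i j) (hr : ∀ i, 0 < r i) (hc : ∀ j, 0 < c j) (hε0 : 0 ≤ ε)
    (hε : ε ≤ 1 / 160)
    (hrow : ∀ i, |∑ j, Y i j - r i| ≤ ε * r i) (hcol : ∀ j, |∑ i, Y i j - c j| ≤ ε * c j) :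
    osc (sinkhornStep Y r c fun _ => 0) ≤ 5 * ε := by
  have hε1 : ε < 1 := by linarith
  have h0 : 0 < 1 - ε := by linarith
  have l := fun i => le_exp_logScale hY (hr i) hε0 hε1 (hrow i)
    (v := logScale (fun j i => Y i j) c fun _ => 0) (M := 1 / ((1 - ε) * 1))
    (fun j => exp_logScale_le (fun j i => hY i j) (hc j) hε1 (hcol j)
      (fun k => by simp) one_pos) (by positivity)
  have h := fun i => exp_logScale_le hY (hr i) hε1 (hrow i)
    (v := logScale (fun j i => Y i j) c fun _ => 0) (M := 1 / ((1 + ε) * 1))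
    (fun j => le_exp_logScale (fun j i => hY i j) (hc j) hε0 hε1 (hcol j)
      (fun k => by simp) one_pos) (by positivity)
  refine osc_le fun i k => ?_
  rw [← Real.exp_le_exp, Real.exp_sub]
  refine (div_le_div₀ (by positivity) (h i) (by positivity) (l k)).trans ?_
  have e1 := inv_one_sub_le_exp hε0 hε
  have e2 := Real.add_one_le_exp ε
  calc _ = (1 / (1 - ε)) * (1 / (1 - ε)) * (ε + 1) * (ε + 1) := by field_simp; ring
    _ ≤ Real.exp (3 / 2 * ε) * Real.exp (3 / 2 * ε) * Real.exp ε * Real.exp ε := by gcongr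
    _ = Real.exp (5 * ε) := by rw [← Real.exp_add, ← Real.exp_add, ← Real.exp_add]; ring_nf

/-- Stability of matrix scaling: if a nonnegative matrix has approximately the margins `(r, c)`
and its normalized Gram matrix is bounded below, then it can be rescaled to `(r, c)` by
potentials of small size. -/
theorem exists_scaling_of_approx {Y : ι → κ → ℝ} {r : ι → ℝ} {c : κ → ℝ} {ε η : ℝ}
    (hY : ∀ i j, 0 ≤ Y i j) (hr : ∀ i, 0 < r i) (hc : ∀ j, 0 < c j)
    (hrc : ∑ i, r i = ∑ j, c j) (hε0 : 0 ≤ ε) (hη0 : 0 < η) (hη1 : η ≤ 1)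
    (hε : 16 * (1 + 9 / η) * ε ≤ 1)
    (hrow : ∀ i, |∑ j, Y i j - r i| ≤ ε * r i) (hcol : ∀ j, |∑ i, Y i j - c j| ≤ ε * c j)
    (hgram : ∀ i k, η / Fintype.card ι ≤ ∑ j, Y i j * Y k j / (r i * c j)) :
    ∃ (u : ι → ℝ) (v : κ → ℝ), (∀ i, ∑ j, Y i j * Real.exp (u i + v j) = r i) ∧
      (∀ j, ∑ i, Y i j * Real.exp (u i + v j) = c j) ∧
      ∀ i j, |u i + v j| ≤ 16 * (1 + 9 / η) * ε := by
  have hcard : (0 : ℝ) < Fintype.card ι := Nat.cast_pos.2 Fintype.card_pos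
  set q := ε / η with hq
  have hεq : ε = q * η := by rw [hq]; field_simp
  have hq0 : 0 ≤ q := div_nonneg hε0 hη0.le
  have hεle : ε ≤ q := by nlinarith
  have hε' : 16 * (1 + 9 / η) * ε = 16 * ε + 144 * q := by rw [hq]; ring
  rw [hε'] at hε ⊢
  have hε160 : ε ≤ 1 / 160 := by linarith
  have hε1 : ε < 1 := by linarith
  have hcol' := fun j => exists_pos_of_abs_sum_sub_le (hc j) hε1 (hcol j)
  have hgram' : ∀ i k, ∃ j, 0 < Y i j ∧ 0 < Y k j := fun i k => by
    have h : 0 < ∑ j, Y i j * Y k j / (r i * c j) := (div_pos hη0 hcard).trans_le (hgram i k)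
    obtain ⟨j, -, hj⟩ := Finset.exists_lt_of_sum_lt (s := Finset.univ) (f := fun _ => (0 : ℝ)) (by simpa using h)
    have hj' := (div_pos_iff_of_pos_right (mul_pos (hr i) (hc j))).1 hj
    have h1 : Y i j ≠ 0 := fun h => by simp [h] at hj'
    have h2 : Y k j ≠ 0 := fun h => by simp [h] at hj'
    exact ⟨j, (hY i j).lt_of_ne' h1, (hY k j).lt_of_ne' h2⟩
  have hrow' : ∀ i, ∃ j, 0 < Y i j := fun i => (hgram' i i).imp fun j h => h.1
  -- The radius makes the contraction gain `3 / 4 * η * B = 6 * ε`, which exceeds the displacement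
  -- `5 * ε` of the zero potential.
  set B := 8 * q with hBdef
  have hB0 : 0 ≤ B := by positivity
  have hθ : 3 / 4 * η ≤ Real.exp (-(2 * B)) * (1 - ε) / (1 + ε) ^ 3 * η := by
    refine mul_le_mul_of_nonneg_right ?_ hη0.le
    -- The smallness hypothesis gives `144 * q ≤ 1`, hence `2 * B ≤ 1 / 9`.
    have h1 : 8 / 9 ≤ Real.exp (-(2 * B)) := by
      have := Real.add_one_le_exp (-(2 * B))
      linarith
    rw [le_div_iff₀ (by positivity)]
    have h3 : (1 + ε) ^ 3 ≤ 11 / 10 := by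
      calc (1 + ε) ^ 3 ≤ (1 + 1 / 160) ^ 3 := by gcongr
        _ ≤ _ := by norm_num
    nlinarith
  have hmap : ∀ u, osc u ≤ B → osc (sinkhornStep Y r c u) ≤ B := fun u hu => by
    refine osc_le fun i l => ?_
    obtain ⟨s, hs, h⟩ := exists_sinkhornStep_sub_eq hY hrow' hcol' r c u (fun _ => 0) i l
    have hz : osc (fun k => 0 + s * (u k - 0)) ≤ B := osc_le fun a b => by
      nlinarith [sub_le_osc u a b, hs.1, hs.2]
    obtain ⟨hi, hhi⟩ := Finite.exists_max u
    obtain ⟨lo, hlo⟩ := Finite.exists_min u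
    have d := sum_sub_mul_le_of_minorized (h := fun k => u k - 0)
      (sum_sinkhornKernel hY hrow' hcol' c _ i)
      (sum_sinkhornKernel hY hrow' hcol' c _ l)
      (fun k => le_sinkhornKernel hY hr hc hε0 hε1 hrow hcol (hgram i k) hz)
      (fun k => le_sinkhornKernel hY hr hc hε0 hε1 hrow hcol (hgram l k) hz)
      (lo := u lo) (hi := u hi) (by simpa using hlo) (by simpa using hhi)
    rw [← h] at d
    have h0 := (sub_le_osc _ i l).trans
      (osc_sinkhornStep_zero_le hY hr hc hε0 hε160 hrow hcol)
    have hosc := (sub_le_osc u hi lo).trans hu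
    have hosc0 : 0 ≤ u hi - u lo := sub_nonneg.2 (hlo hi)
    have he : Fintype.card ι * (Real.exp (-(2 * B)) * (1 - ε) / (1 + ε) ^ 3
        * (η / Fintype.card ι)) = Real.exp (-(2 * B)) * (1 - ε) / (1 + ε) ^ 3 * η := by
      field_simp
    rw [he] at d
    have d2 : (1 - Real.exp (-(2 * B)) * (1 - ε) / (1 + ε) ^ 3 * η) * (u hi - u lo)
        ≤ (1 - 3 / 4 * η) * B :=
      (mul_le_mul_of_nonneg_right (by linarith) hosc0).trans
        (mul_le_mul_of_nonneg_left hosc (by linarith))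
    have : 3 / 4 * η * B = 6 * ε := by rw [hBdef, hεq]; ring
    linarith
  obtain ⟨u, hu, h1, h2⟩ := exists_scaling_of_mapsTo hY hcol' hgram' hr hc hrc hB0 hmap
  refine ⟨u, _, h1, h2, fun i j => ?_⟩
  -- Every row potential lies within `B` of `u i`, so the column potential is `-u i` up to `B + 3 /
  -- 2 * ε`, well within the claimed bound.
  have up : Real.exp (logScale (fun j i => Y i j) c u j) ≤ 1 / ((1 - ε) * Real.exp (u i - B)) :=
    exp_logScale_le (fun j i => hY i j) (hc j) hε1 (hcol j)
      (fun k => Real.exp_le_exp.2 (by linarith [sub_le_osc u i k])) (Real.exp_pos _)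
  have dn : 1 / ((1 + ε) * Real.exp (u i + B)) ≤ Real.exp (logScale (fun j i => Y i j) c u j) :=
    le_exp_logScale (fun j i => hY i j) (hc j) hε0 hε1 (hcol j)
      (fun k => Real.exp_le_exp.2 (by linarith [sub_le_osc u k i])) (Real.exp_pos _)
  have up' : logScale (fun j i => Y i j) c u j ≤ 3 / 2 * ε - (u i - B) := by
    rw [← Real.exp_le_exp, Real.exp_sub]
    refine up.trans ?_
    rw [← div_div]
    exact div_le_div_of_nonneg_right (inv_one_sub_le_exp hε0 hε160) (Real.exp_pos _).le
  have dn' : -ε - (u i + B) ≤ logScale (fun j i => Y i j) c u j := by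
    rw [← Real.exp_le_exp, Real.exp_sub, Real.exp_neg]
    refine le_trans ?_ dn
    rw [← div_div, ← one_div]
    refine div_le_div_of_nonneg_right ?_ (Real.exp_pos _).le
    exact one_div_le_one_div_of_le (by linarith) (by linarith [Real.add_one_le_exp ε])
  rw [abs_le]
  constructor <;> linarith

end ApproximateScaling

/-! ### A priori bounds on the scaling factors of the mean. -/

section PotentialBounds

/-- Under a bounded cost, the scaling factors are comparable to `N / ‖L‖₁`. -/
theorem scaling_factor_bounds {ι κ : Type*} [Fintype ι] [Fintype κ] {L : ι → κ → ℝ} {r : ι → ℝ}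
    {c : κ → ℝ} {a : ι → ℝ} {b : κ → ℝ} {K S N : ℝ} (hL : ∀ i j, 0 < L i j)
    (hr : ∀ i, 0 < r i) (hc : ∀ j, 0 < c j) (ha : ∀ i, 0 < a i) (hb : ∀ j, 0 < b j)
    (hN : 0 < N) (hS : 0 < S) (hSsum : ∑ i, ∑ j, L i j = S) (hNr : ∑ i, r i = N)
    (hNc : ∑ j, c j = N) (hrow : ∀ i, ∑ j, a i * L i j * b j = r i)
    (hcol : ∀ j, ∑ i, a i * L i j * b j = c j)
    (hK : ∀ i j, |Real.log (r i * c j * S / (L i j * N ^ 2))| ≤ K) (i : ι) (j : κ) :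
    Real.exp (-(3 * K)) * (N / S) ≤ a i * b j ∧ a i * b j ≤ Real.exp (2 * K) * (N / S) := by
  have hpos : ∀ i j, 0 < r i * c j * S / (L i j * N ^ 2) := fun i j =>
    div_pos (mul_pos (mul_pos (hr i) (hc j)) hS) (mul_pos (hL i j) (by positivity))
  have up : ∀ i j, r i * c j * S ≤ Real.exp K * (L i j * N ^ 2) := fun i j => by
    have h := (Real.log_le_iff_le_exp (hpos i j)).1 (abs_le.1 (hK i j)).2
    rwa [div_le_iff₀ (mul_pos (hL i j) (by positivity))] at h
  have dn : ∀ i j, Real.exp (-K) * (L i j * N ^ 2) ≤ r i * c j * S := fun i j => by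
    have h := (Real.le_log_iff_exp_le (hpos i j)).1 (abs_le.1 (hK i j)).1
    rwa [le_div_iff₀ (mul_pos (hL i j) (by positivity))] at h
  -- The cost condition allows `L i j` to be replaced by `r i * c j * S / N ^ 2` in the margin
  -- equations up to `exp (± K)`. This fixes `a i * B` and `b j * A`, so only the product `A * B`
  -- remains to be bounded.
  set A := ∑ i, r i * a i with hA
  set B := ∑ j, c j * b j with hB
  have hA0 : 0 < A := Finset.sum_pos (fun i _ => mul_pos (hr i) (ha i)) ⟨i, Finset.mem_univ i⟩
  have hB0 : 0 < B := Finset.sum_pos (fun j _ => mul_pos (hc j) (hb j)) ⟨j, Finset.mem_univ j⟩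
  have aup : ∀ i, a i * B * S ≤ Real.exp K * N ^ 2 := fun i => by
    refine le_of_mul_le_mul_left ?_ (hr i)
    calc r i * (a i * B * S) = ∑ j, a i * (r i * c j * S) * b j := by
          rw [hB, Finset.mul_sum, Finset.sum_mul, Finset.mul_sum]
          exact Finset.sum_congr rfl fun j _ => by ring
      _ ≤ ∑ j, a i * (Real.exp K * (L i j * N ^ 2)) * b j := by
          refine Finset.sum_le_sum fun j _ => ?_
          have := (ha i).le
          have := (hb j).le
          have := up i j
          gcongr
      _ = r i * (Real.exp K * N ^ 2) := by
          rw [← hrow i, Finset.sum_mul]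
          exact Finset.sum_congr rfl fun j _ => by ring
  have adn : ∀ i, Real.exp (-K) * N ^ 2 ≤ a i * B * S := fun i => by
    refine le_of_mul_le_mul_left ?_ (hr i)
    calc r i * (Real.exp (-K) * N ^ 2) = ∑ j, a i * (Real.exp (-K) * (L i j * N ^ 2)) * b j := by
          rw [← hrow i, Finset.sum_mul]
          exact Finset.sum_congr rfl fun j _ => by ring
      _ ≤ ∑ j, a i * (r i * c j * S) * b j := by
          refine Finset.sum_le_sum fun j _ => ?_
          have := (ha i).le
          have := (hb j).le
          have := dn i j
          gcongr
      _ = r i * (a i * B * S) := by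
          rw [hB, Finset.mul_sum, Finset.sum_mul, Finset.mul_sum]
          exact Finset.sum_congr rfl fun j _ => by ring
  have bup : ∀ j, b j * A * S ≤ Real.exp K * N ^ 2 := fun j => by
    refine le_of_mul_le_mul_left ?_ (hc j)
    calc c j * (b j * A * S) = ∑ i, a i * (r i * c j * S) * b j := by
          rw [hA, Finset.mul_sum, Finset.sum_mul, Finset.mul_sum]
          exact Finset.sum_congr rfl fun j _ => by ring
      _ ≤ ∑ i, a i * (Real.exp K * (L i j * N ^ 2)) * b j := by
          refine Finset.sum_le_sum fun i _ => ?_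
          have := (ha i).le
          have := (hb j).le
          have := up i j
          gcongr
      _ = c j * (Real.exp K * N ^ 2) := by
          rw [← hcol j, Finset.sum_mul]
          exact Finset.sum_congr rfl fun j _ => by ring
  have bdn : ∀ j, Real.exp (-K) * N ^ 2 ≤ b j * A * S := fun j => by
    refine le_of_mul_le_mul_left ?_ (hc j)
    calc c j * (Real.exp (-K) * N ^ 2) = ∑ i, a i * (Real.exp (-K) * (L i j * N ^ 2)) * b j := by
          rw [← hcol j, Finset.sum_mul]
          exact Finset.sum_congr rfl fun j _ => by ring
      _ ≤ ∑ i, a i * (r i * c j * S) * b j := by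
          refine Finset.sum_le_sum fun i _ => ?_
          have := (ha i).le
          have := (hb j).le
          have := dn i j
          gcongr
      _ = c j * (b j * A * S) := by
          rw [hA, Finset.mul_sum, Finset.sum_mul, Finset.mul_sum]
          exact Finset.sum_congr rfl fun j _ => by ring
  have ABup : A * B * S ≤ Real.exp K * N ^ 3 := by
    calc A * B * S = ∑ i, r i * (a i * B * S) := by
          rw [hA, Finset.sum_mul, Finset.sum_mul]
          exact Finset.sum_congr rfl fun i _ => by ring
      _ ≤ ∑ i, r i * (Real.exp K * N ^ 2) :=
          Finset.sum_le_sum fun i _ => mul_le_mul_of_nonneg_left (aup i) (hr i).le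
      _ = Real.exp K * N ^ 3 := by rw [← Finset.sum_mul, hNr]; ring
  -- Gibbs' inequality for the rescaled matrix relative to `L`, and Jensen's inequality
  have key : ∀ i j, a i * L i j * b j - N / S * L i j
      ≤ a i * L i j * b j * Real.log (S * (A * B) / N ^ 3)
        + (a i * L i j * b j * (a i * N / A - 1) + a i * L i j * b j * (b j * N / B - 1)) := by
    intro i j
    have hai := ha i
    have hbj := hb j
    have hLij := hL i j
    have h1 : Real.log (N / (S * (a i * b j))) ≤ N / (S * (a i * b j)) - 1 :=
      Real.log_le_sub_one_of_pos (by positivity)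
    have h2 : Real.log (a i * N / A) ≤ a i * N / A - 1 :=
      Real.log_le_sub_one_of_pos (by positivity)
    have h3 : Real.log (b j * N / B) ≤ b j * N / B - 1 :=
      Real.log_le_sub_one_of_pos (by positivity)
    have h4 : Real.log (N / (S * (a i * b j))) + Real.log (S * (A * B) / N ^ 3)
        + Real.log (a i * N / A) + Real.log (b j * N / B) = 0 := by
      rw [← Real.log_mul (by positivity) (by positivity),
        ← Real.log_mul (by positivity) (by positivity),
        ← Real.log_mul (by positivity) (by positivity), Real.log_eq_zero]
      right; left
      field_simp
    have h5 : 1 - N / (S * (a i * b j)) ≤ Real.log (S * (A * B) / N ^ 3)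
        + (a i * N / A - 1) + (b j * N / B - 1) := by linarith
    have h6 : 0 ≤ a i * L i j * b j := by positivity
    calc a i * L i j * b j - N / S * L i j
        = a i * L i j * b j * (1 - N / (S * (a i * b j))) := by field_simp
      _ ≤ _ := (mul_le_mul_of_nonneg_left h5 h6).trans_eq (by ring)
  have hsum := Finset.sum_le_sum fun i (_ : i ∈ Finset.univ) =>
    Finset.sum_le_sum fun j (_ : j ∈ Finset.univ) => key i j
  simp only [Finset.sum_sub_distrib, Finset.sum_add_distrib, ← Finset.mul_sum, hSsum] at hsum
  have e1 : ∑ i, ∑ j, a i * L i j * b j * (a i * N / A - 1) = 0 := by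
    rw [Finset.sum_congr rfl fun i _ => by rw [← Finset.sum_mul, hrow i]]
    simp_rw [mul_sub, mul_one, Finset.sum_sub_distrib, hNr]
    rw [show ∑ i, r i * (a i * N / A) = (∑ i, r i * a i) * N / A by
      rw [Finset.sum_mul, Finset.sum_div]; exact Finset.sum_congr rfl fun i _ => by ring, ← hA]
    field_simp
    ring
  have e2 : ∑ i, ∑ j, a i * L i j * b j * (b j * N / B - 1) = 0 := by
    rw [Finset.sum_comm]
    rw [Finset.sum_congr rfl fun j _ => by rw [← Finset.sum_mul, hcol j]]
    simp_rw [mul_sub, mul_one, Finset.sum_sub_distrib, hNc]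
    rw [show ∑ j, c j * (b j * N / B) = (∑ j, c j * b j) * N / B by
      rw [Finset.sum_mul, Finset.sum_div]; exact Finset.sum_congr rfl fun i _ => by ring, ← hB]
    field_simp
    ring
  have e3 : ∑ i, ∑ j, a i * L i j * b j = N := by simp_rw [hrow, hNr]
  rw [e1, e2] at hsum
  simp_rw [← Finset.sum_mul, e3] at hsum
  have hlog : 0 ≤ Real.log (S * (A * B) / N ^ 3) := by
    rw [div_mul_cancel₀ _ hS.ne', sub_self, add_zero, add_zero] at hsum
    exact nonneg_of_mul_nonneg_right hsum hN
  have ABdn : N ^ 3 ≤ A * B * S := by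
    have := (Real.log_nonneg_iff (by positivity)).1 hlog
    rw [le_div_iff₀ (by positivity)] at this
    linarith
  have hai := ha i
  have hbj := hb j
  -- Both bounds follow from `(a i * b j * S) * (A * B * S) = (a i * B * S) * (b j * A * S)`; the
  -- lower one loses a third `exp K` because `ABup` does, while `ABdn` costs nothing.
  constructor
  · rw [mul_div_assoc', div_le_iff₀ hS]
    refine le_of_mul_le_mul_right ?_ (show 0 < A * B * S by positivity)
    calc Real.exp (-(3 * K)) * N * (A * B * S)
        ≤ Real.exp (-(3 * K)) * N * (Real.exp K * N ^ 3) := by gcongr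
      _ = (Real.exp (-K) * N ^ 2) * (Real.exp (-K) * N ^ 2) := by
          have : Real.exp (-(3 * K)) * Real.exp K = Real.exp (-K) * Real.exp (-K) := by
            rw [← Real.exp_add, ← Real.exp_add]; ring_nf
          linear_combination N ^ 4 * this
      _ ≤ (a i * B * S) * (b j * A * S) :=
          mul_le_mul (adn i) (bdn j) (by positivity) (by positivity)
      _ = _ := by ring
  · rw [mul_div_assoc', le_div_iff₀ hS]
    refine le_of_mul_le_mul_right ?_ (show 0 < A * B * S by positivity)
    calc a i * b j * S * (A * B * S) = (a i * B * S) * (b j * A * S) := by ring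
      _ ≤ (Real.exp K * N ^ 2) * (Real.exp K * N ^ 2) :=
          mul_le_mul (aup i) (bup j) (by positivity) (by positivity)
      _ = Real.exp (2 * K) * N * N ^ 3 := by
          have : Real.exp (2 * K) = Real.exp K * Real.exp K := by
            rw [← Real.exp_add]; ring_nf
          rw [this]; ring
      _ ≤ Real.exp (2 * K) * N * (A * B * S) := by gcongr

end PotentialBounds

/-! ### Bernstein inequalities and a lower-tail bound for nonnegative sums. -/

section Concentration

variable {Ω : Type*} [MeasurableSpace Ω] {μ : Measure Ω}

theorem hasSum_pow_div_factorial (x : ℝ) :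
    HasSum (fun q : ℕ => x ^ q / (q.factorial : ℝ)) (Real.exp x) := by
  rw [Real.exp_eq_exp_ℝ]
  exact NormedSpace.expSeries_div_hasSum_exp x

theorem integrable_exp_of_summable_moments {Z : Ω → ℝ}
    (hint : ∀ q : ℕ, Integrable (fun ω => |Z ω| ^ q) μ)
    (hsum : Summable fun q : ℕ => ∫ ω, |Z ω| ^ q / (q.factorial : ℝ) ∂μ)
    (hZ : AEMeasurable Z μ) : Integrable (fun ω => Real.exp (Z ω)) μ := by
  have hnn : ∀ (q : ℕ) ω, 0 ≤ |Z ω| ^ q / (q.factorial : ℝ) := fun q ω => by positivity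
  refine ⟨hZ.exp.aestronglyMeasurable, ?_⟩
  have hle : ∀ ω, ‖Real.exp (Z ω)‖ₑ ≤ ∑' q : ℕ, ENNReal.ofReal (|Z ω| ^ q / (q.factorial : ℝ)) :=
    fun ω => by
      rw [← ENNReal.ofReal_tsum_of_nonneg (fun q => hnn q ω)
        (hasSum_pow_div_factorial |Z ω|).summable, (hasSum_pow_div_factorial |Z ω|).tsum_eq,
        Real.enorm_eq_ofReal (Real.exp_pos _).le]
      exact ENNReal.ofReal_le_ofReal (Real.exp_le_exp.2 (le_abs_self _))
  refine (lintegral_mono hle).trans_lt ?_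
  rw [lintegral_tsum fun q => by fun_prop]
  have : ∀ q : ℕ, ∫⁻ ω, ENNReal.ofReal (|Z ω| ^ q / (q.factorial : ℝ)) ∂μ
      = ENNReal.ofReal (∫ ω, |Z ω| ^ q / (q.factorial : ℝ) ∂μ) := fun q =>
    (ofReal_integral_eq_lintegral_ofReal ((hint q).div_const _)
      (Filter.Eventually.of_forall (hnn q))).symm
  simp_rw [this]
  rw [← ENNReal.ofReal_tsum_of_nonneg (fun q => integral_nonneg (hnn q)) hsum]
  exact ENNReal.ofReal_lt_top

/-- Bernstein's bound on the moment generating function of a centered random variable. -/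
theorem integral_exp_le_of_moments [IsProbabilityMeasure μ] {Z : Ω → ℝ} {σ R s : ℝ}
    (hZ : Integrable Z μ) (h0 : ∫ ω, Z ω ∂μ = 0)
    (hint : ∀ q : ℕ, 2 ≤ q → Integrable (fun ω => |Z ω| ^ q) μ)
    (hm : ∀ q : ℕ, 2 ≤ q →
      ∫ ω, |Z ω| ^ q ∂μ ≤ (q.factorial : ℝ) / 2 * σ ^ 2 * R ^ (q - 2))
    (hR : 0 ≤ R) (hs : |s| * R < 1) :
    Integrable (fun ω => Real.exp (s * Z ω)) μ ∧
      ∫ ω, Real.exp (s * Z ω) ∂μ ≤ Real.exp (σ ^ 2 * s ^ 2 / (2 * (1 - |s| * R))) := by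
  have hint' : ∀ q : ℕ, Integrable (fun ω => |s * Z ω| ^ q) μ := fun q => by
    simp_rw [abs_mul, mul_pow]
    refine Integrable.const_mul ?_ _
    rcases q with _ | _ | q
    · simp
    · simpa using hZ.abs
    · exact hint _ (by omega)
  have hb : ∀ q : ℕ, ∫ ω, |s * Z ω| ^ (q + 2) / ((q + 2).factorial : ℝ) ∂μ
      ≤ σ ^ 2 * s ^ 2 / 2 * (|s| * R) ^ q := fun q => by
    simp_rw [abs_mul, mul_pow, mul_div_right_comm]
    rw [integral_const_mul]
    have hf : (0 : ℝ) < ((q + 2).factorial : ℝ) := by positivity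
    calc _ ≤ |s| ^ (q + 2) / ((q + 2).factorial : ℝ) *
          (((q + 2).factorial : ℝ) / 2 * σ ^ 2 * R ^ q) :=
          mul_le_mul_of_nonneg_left (hm (q + 2) (by omega)) (by positivity)
      _ = σ ^ 2 * s ^ 2 / 2 * (|s| ^ q * R ^ q) := by
          rw [← sq_abs s, pow_add]
          field_simp
      _ = _ := by ring
  have hgeo := hasSum_geometric_of_lt_one (mul_nonneg (abs_nonneg s) hR) hs
  have hnn : ∀ q : ℕ, 0 ≤ ∫ ω, |s * Z ω| ^ q / (q.factorial : ℝ) ∂μ := fun q =>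
    integral_nonneg fun ω => by positivity
  have hsum : Summable fun q : ℕ => ∫ ω, |s * Z ω| ^ q / (q.factorial : ℝ) ∂μ :=
    (summable_nat_add_iff 2).1 (Summable.of_nonneg_of_le (fun q => hnn _) hb
      (hgeo.summable.mul_left _))
  have hI := integrable_exp_of_summable_moments hint' hsum (hZ.aemeasurable.const_mul s)
  refine ⟨hI, ?_⟩
  -- The linear term keeps its sign so that it integrates to zero; absolute values enter only from
  -- order two on, where the moments give a geometric series.
  have hpt : ∀ ω, Real.exp (s * Z ω)
      ≤ 1 + s * Z ω + ∑' q : ℕ, |s * Z ω| ^ (q + 2) / ((q + 2).factorial : ℝ) := fun ω => by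
    have h1 := (hasSum_pow_div_factorial (s * Z ω))
    have h2 := (hasSum_pow_div_factorial |s * Z ω|).summable
    rw [← h1.tsum_eq, ← h1.summable.sum_add_tsum_nat_add 2]
    have h3 : ∑ q ∈ Finset.range 2, (s * Z ω) ^ q / (q.factorial : ℝ) = 1 + s * Z ω := by
      simp [Finset.sum_range_succ]
    rw [h3]
    refine add_le_add_right (Summable.tsum_le_tsum (fun q => ?_)
      ((summable_nat_add_iff 2).2 h1.summable) ((summable_nat_add_iff 2).2 h2)) _
    refine div_le_div_of_nonneg_right ?_ (by positivity)
    rw [← abs_pow]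
    exact le_abs_self _
  have htail := hasSum_integral_of_summable_integral_norm (μ := μ)
    (F := fun (q : ℕ) ω => |s * Z ω| ^ (q + 2) / ((q + 2).factorial : ℝ))
    (fun q => (hint' (q + 2)).div_const _) (by
      refine ((summable_nat_add_iff 2).2 hsum).congr fun q => ?_
      refine integral_congr_ae (Filter.Eventually.of_forall fun ω => ?_)
      exact (Real.norm_of_nonneg (by positivity)).symm)
  have htailI : Integrable
      (fun ω => ∑' q : ℕ, |s * Z ω| ^ (q + 2) / ((q + 2).factorial : ℝ)) μ := by
    have hE := integrable_exp_of_summable_moments (Z := fun ω => |s * Z ω|)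
      (by simpa only [abs_abs] using hint') (by simpa only [abs_abs] using hsum)
      (hZ.aemeasurable.const_mul s).abs
    have hE2 : Integrable (fun ω => Real.exp |s * Z ω| - (1 + |s * Z ω|)) μ :=
      hE.sub ((integrable_const 1).add (hZ.const_mul s).abs)
    refine hE2.congr (Filter.Eventually.of_forall fun ω => ?_)
    have h1 := hasSum_pow_div_factorial |s * Z ω|
    simp only
    rw [← h1.tsum_eq, ← h1.summable.sum_add_tsum_nat_add 2]
    simp [Finset.sum_range_succ]
  have hlin : Integrable (fun ω => 1 + s * Z ω) μ := (integrable_const 1).add (hZ.const_mul s)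
  calc ∫ ω, Real.exp (s * Z ω) ∂μ
      ≤ ∫ ω, (1 + s * Z ω + ∑' q : ℕ, |s * Z ω| ^ (q + 2) / ((q + 2).factorial : ℝ)) ∂μ :=
        integral_mono hI (hlin.add htailI) hpt
    _ = 1 + ∑' q : ℕ, ∫ ω, |s * Z ω| ^ (q + 2) / ((q + 2).factorial : ℝ) ∂μ := by
        rw [integral_add hlin htailI, integral_add (integrable_const 1) (hZ.const_mul s),
          integral_const_mul, h0, htail.tsum_eq]
        simp
    _ ≤ 1 + ∑' q : ℕ, σ ^ 2 * s ^ 2 / 2 * (|s| * R) ^ q := by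
        refine add_le_add_right (Summable.tsum_le_tsum hb ((summable_nat_add_iff 2).2 hsum)
          (hgeo.summable.mul_left _)) _
    _ = σ ^ 2 * s ^ 2 / (2 * (1 - |s| * R)) + 1 := by
        rw [tsum_mul_left, hgeo.tsum_eq, ← div_eq_mul_inv, div_div, add_comm]
    _ ≤ _ := Real.add_one_le_exp _

/-- One-sided Bernstein inequality for weighted sums of independent centered variables. -/
theorem measureReal_le_exp_of_bernstein {ι : Type*} [Fintype ι] [Nonempty ι]
    {Z : ι → Ω → ℝ} {w : ι → ℝ} {σ R W τ : ℝ} (hind : iIndepFun Z μ)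
    (hZ : ∀ i, Integrable (Z i) μ) (h0 : ∀ i, ∫ ω, Z i ω ∂μ = 0)
    (hint : ∀ i, ∀ q : ℕ, 2 ≤ q → Integrable (fun ω => |Z i ω| ^ q) μ)
    (hm : ∀ i, ∀ q : ℕ, 2 ≤ q →
      ∫ ω, |Z i ω| ^ q ∂μ ≤ (q.factorial : ℝ) / 2 * σ ^ 2 * R ^ (q - 2))
    (hσ : 0 < σ) (hR : 0 < R) (hW : 0 < W) (hτ : 0 ≤ τ) (hw : ∀ i, |w i| ≤ W) :
    μ.real {ω | W * (σ * Real.sqrt (2 * Fintype.card ι * τ) + R * τ) ≤ ∑ i, w i * Z i ω}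
      ≤ Real.exp (-τ) := by
  have := hind.isProbabilityMeasure
  set k : ℝ := (Fintype.card ι : ℝ) with hk
  have hk0 : 0 < k := Nat.cast_pos.2 Fintype.card_pos
  set ρ := Real.sqrt (2 * k * τ) with hρ
  have hρ0 : 0 ≤ ρ := Real.sqrt_nonneg _
  have hρ2 : ρ ^ 2 = 2 * k * τ := Real.sq_sqrt (by positivity)
  -- With this choice of `s`, `1 - s * W * R = 1 / (1 + R * y)` and the Chernoff exponent equals
  -- `-τ` exactly.
  set y := ρ / (k * σ) with hy
  have hy0 : 0 ≤ y := by positivity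
  have hRy : 0 < 1 + R * y := by positivity
  set s := y / (W * (1 + R * y)) with hs
  have hs0 : 0 ≤ s := by positivity
  have hsWR : s * W * R = R * y / (1 + R * y) := by rw [hs]; field_simp
  have h1s : 1 - s * W * R = 1 / (1 + R * y) := by rw [hsWR]; field_simp; ring
  have h1s0 : 0 < 1 - s * W * R := by rw [h1s]; positivity
  have hsw : ∀ i, |s * w i| ≤ s * W := fun i => by
    rw [abs_mul, abs_of_nonneg hs0]
    exact mul_le_mul_of_nonneg_left (hw i) hs0
  have hmg := fun i => integral_exp_le_of_moments (hZ i) (h0 i) (hint i) (hm i) hR.le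
    (s := s * w i) (by nlinarith [hsw i])
  set V : ι → Ω → ℝ := fun i ω => w i * Z i ω with hV
  have hVm : ∀ i, AEMeasurable (V i) μ := fun i => (hZ i).aemeasurable.const_mul _
  have hVind : iIndepFun V μ := hind.comp (fun i x => w i * x) fun i => by fun_prop
  have hVexp : ∀ i, Integrable (fun ω => Real.exp (s * V i ω)) μ := fun i => by
    simpa only [hV, mul_assoc] using (hmg i).1
  have hVmgf : ∀ i, mgf (V i) μ s
      ≤ Real.exp (σ ^ 2 * (s * W) ^ 2 / (2 * (1 - s * W * R))) := fun i => by
    have h := (hmg i).2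
    simp only [mul_assoc] at h
    refine h.trans (Real.exp_le_exp.2 ?_)
    have h2 : (s * w i) ^ 2 ≤ (s * W) ^ 2 := sq_le_sq' (by linarith [(abs_le.1 (hsw i)).1])
      (abs_le.1 (hsw i)).2
    have h3 : |s * w i| * R ≤ s * W * R := mul_le_mul_of_nonneg_right (hsw i) hR.le
    gcongr
  have hch := measure_ge_le_exp_mul_mgf (μ := μ) (X := ∑ i, V i)
    (W * (σ * ρ + R * τ)) hs0 (by
      -- A nonintegrable exponential would have integral `0` by convention, contradicting the
      -- factorization into positive generating functions.
      by_contra h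
      have h2 := Finset.prod_pos fun i (_ : i ∈ Finset.univ) => mgf_pos (hVexp i)
      rw [← hVind.mgf_sum₀ hVm, mgf, integral_undef h] at h2
      exact h2.false)
  rw [hVind.mgf_sum₀ hVm] at hch
  simp only [Finset.sum_apply] at hch
  refine hch.trans ?_
  calc _ ≤ Real.exp (-s * (W * (σ * ρ + R * τ))) *
        ∏ _i : ι, Real.exp (σ ^ 2 * (s * W) ^ 2 / (2 * (1 - s * W * R))) := by
        refine mul_le_mul_of_nonneg_left ?_ (Real.exp_pos _).le
        exact Finset.prod_le_prod (fun i _ => mgf_nonneg) fun i _ => hVmgf i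
    _ = Real.exp (-τ) := by
        rw [Finset.prod_const, ← Real.exp_nat_mul, ← Real.exp_add, Finset.card_univ, ← hk, h1s]
        congr 1
        have hsW : s * W = y / (1 + R * y) := by rw [hs]; field_simp
        have e1 : -s * (W * (σ * ρ + R * τ)) = -(y * (σ * ρ + R * τ)) / (1 + R * y) := by
          rw [hs]; field_simp
        have e2 : y * (σ * ρ) = 2 * τ := by
          rw [hy]; field_simp; linarith
        have e3 : k * σ ^ 2 * y ^ 2 = 2 * τ := by
          rw [hy]; field_simp; linarith
        rw [e1, hsW]
        clear_value y
        field_simp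
        linear_combination (-2) * e2 + e3

/-- Two-sided Bernstein inequality for weighted sums of independent centered variables. -/
theorem measureReal_abs_le_exp_of_bernstein {ι : Type*} [Fintype ι] [Nonempty ι]
    {Z : ι → Ω → ℝ} {w : ι → ℝ} {σ R W τ : ℝ} (hind : iIndepFun Z μ)
    (hZ : ∀ i, Integrable (Z i) μ) (h0 : ∀ i, ∫ ω, Z i ω ∂μ = 0)
    (hint : ∀ i, ∀ q : ℕ, 2 ≤ q → Integrable (fun ω => |Z i ω| ^ q) μ)
    (hm : ∀ i, ∀ q : ℕ, 2 ≤ q →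
      ∫ ω, |Z i ω| ^ q ∂μ ≤ (q.factorial : ℝ) / 2 * σ ^ 2 * R ^ (q - 2))
    (hσ : 0 < σ) (hR : 0 < R) (hτ : 0 ≤ τ) (hw : ∀ i, |w i| ≤ W) :
    μ.real {ω | W * (σ * Real.sqrt (2 * Fintype.card ι * τ) + R * τ) < |∑ i, w i * Z i ω|}
      ≤ 2 * Real.exp (-τ) := by
  have := hind.isProbabilityMeasure
  have hW0 : 0 ≤ W := (abs_nonneg _).trans (hw (Classical.arbitrary ι))
  rcases hW0.eq_or_lt with rfl | hW
  · have : ∀ i, w i = 0 := fun i => abs_nonpos_iff.1 (hw i)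
    simp [this, Real.exp_nonneg]
  have h1 := measureReal_le_exp_of_bernstein hind hZ h0 hint hm hσ hR hW hτ hw
  have h2 := measureReal_le_exp_of_bernstein hind hZ h0 hint hm hσ hR hW hτ (w := fun i => -w i)
    fun i => by rw [abs_neg]; exact hw i
  refine le_trans (measureReal_mono ?_ (measure_ne_top μ _))
    ((measureReal_union_le _ _).trans ((add_le_add h1 h2).trans_eq (two_mul _).symm))
  intro ω hω
  rw [Set.mem_ofPred_eq] at hω
  rcases lt_abs.1 hω with h | h
  · exact Or.inl h.le
  · refine Or.inr ?_
    simpa using h.le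

/-- `(1 + z + z ^ 2 / 2) * (1 - z + z ^ 2 / 2) = 1 + z ^ 4 / 4 ≥ 1`. -/
theorem exp_neg_le_quadratic {z : ℝ} (hz : 0 ≤ z) : Real.exp (-z) ≤ 1 - z + z ^ 2 / 2 := by
  have h := Real.quadratic_le_exp_of_nonneg hz
  rw [Real.exp_neg, inv_le_iff_one_le_mul₀ (Real.exp_pos _)]
  have h2 : 0 ≤ 1 - z + z ^ 2 / 2 := by nlinarith [sq_nonneg (z - 1)]
  nlinarith [mul_le_mul_of_nonneg_left h h2, sq_nonneg (z ^ 2)]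

/-- Lower tail of a sum of nonnegative variables with bounded second moments. -/
theorem measureReal_sum_le_half_le {κ : Type*} [Fintype κ] [IsProbabilityMeasure μ]
    {Z : κ → Ω → ℝ} {M V : ℝ} (hZ : ∀ j, Integrable (Z j) μ)
    (hZ2 : ∀ j, Integrable (fun ω => Z j ω ^ 2) μ) (hnn : ∀ j, ∀ᵐ ω ∂μ, 0 ≤ Z j ω)
    (hind : ∀ (s : Finset κ) (j : κ), j ∉ s → IndepFun (Z j) (∑ l ∈ s, Z l) μ)
    (hM0 : 0 ≤ M) (hV0 : 0 < V) (hM : ∀ j, M ≤ ∫ ω, Z j ω ∂μ)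
    (hV : ∀ j, ∫ ω, Z j ω ^ 2 ∂μ ≤ V) :
    μ.real {ω | ∑ j, Z j ω ≤ Fintype.card κ * M / 2}
      ≤ Real.exp (-(Fintype.card κ * M ^ 2 / (8 * V))) := by
  classical
  -- The minimizer of the per-term exponent `-s * M / 2 + s ^ 2 * V / 2`, with value `-M ^ 2 / (8 *
  -- V)`.
  set s := M / (2 * V) with hs
  have hs0 : 0 ≤ s := by positivity
  have hm : ∀ j, AEMeasurable (Z j) μ := fun j => (hZ j).aemeasurable
  have hmgf : ∀ S : Finset κ, mgf (∑ j ∈ S, Z j) μ (-s) = ∏ j ∈ S, mgf (Z j) μ (-s) := by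
    intro S
    induction S using Finset.induction_on with
    | empty => simp
    | insert j S hj ih =>
      rw [Finset.sum_insert hj, (hind S j hj).mgf_add' (hm j).aestronglyMeasurable
        (Finset.aemeasurable_sum _ fun i _ => hm i).aestronglyMeasurable, ih,
        Finset.prod_insert hj]
  have hint : ∀ j, Integrable (fun ω => Real.exp (-s * Z j ω)) μ := fun j => by
    refine Integrable.mono' (integrable_const 1)
      ((hm j).const_mul _).exp.aestronglyMeasurable ?_
    filter_upwards [hnn j] with ω hω
    rw [Real.norm_of_nonneg (Real.exp_pos _).le, Real.exp_le_one_iff]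
    nlinarith
  have hintS : Integrable (fun ω => Real.exp (-s * (∑ j, Z j) ω)) μ := by
    refine Integrable.mono' (integrable_const 1)
      ((Finset.aemeasurable_sum _ fun i _ => hm i).const_mul _).exp.aestronglyMeasurable ?_
    filter_upwards [ae_all_iff.2 hnn] with ω hω
    rw [Real.norm_of_nonneg (Real.exp_pos _).le, Real.exp_le_one_iff, Finset.sum_apply]
    nlinarith [Finset.sum_nonneg fun j (_ : j ∈ Finset.univ) => hω j]
  have hone : ∀ j, mgf (Z j) μ (-s) ≤ Real.exp (-(s * M) + s ^ 2 * V / 2) := fun j => by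
    have hI : Integrable (fun ω => 1 - s * Z j ω + s ^ 2 / 2 * Z j ω ^ 2) μ :=
      ((integrable_const 1).sub ((hZ j).const_mul s)).add ((hZ2 j).const_mul _)
    calc mgf (Z j) μ (-s) ≤ ∫ ω, (1 - s * Z j ω + s ^ 2 / 2 * Z j ω ^ 2) ∂μ := by
          refine integral_mono_ae (hint j) hI ?_
          filter_upwards [hnn j] with ω hω
          have := exp_neg_le_quadratic (mul_nonneg hs0 hω)
          rw [neg_mul]
          nlinarith
      _ = 1 - s * ∫ ω, Z j ω ∂μ + s ^ 2 / 2 * ∫ ω, Z j ω ^ 2 ∂μ := by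
          have hI1 : Integrable (fun ω => 1 - s * Z j ω) μ :=
            (integrable_const 1).sub ((hZ j).const_mul s)
          rw [integral_add hI1 ((hZ2 j).const_mul _), integral_sub (integrable_const 1) ((hZ j).const_mul s),
            integral_const_mul, integral_const_mul]
          simp
      _ ≤ -(s * M) + s ^ 2 * V / 2 + 1 := by
          have h1 := mul_le_mul_of_nonneg_left (hM j) hs0
          have h2 := mul_le_mul_of_nonneg_left (hV j) (show 0 ≤ s ^ 2 / 2 by positivity)
          linarith
      _ ≤ _ := Real.add_one_le_exp _
  have hch := measure_le_le_exp_mul_mgf (μ := μ) (X := ∑ j, Z j) (Fintype.card κ * M / 2)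
    (neg_nonpos.2 hs0) hintS
  rw [hmgf] at hch
  simp only [Finset.sum_apply] at hch
  refine hch.trans ?_
  calc _ ≤ Real.exp (- -s * (Fintype.card κ * M / 2)) *
        ∏ _j : κ, Real.exp (-(s * M) + s ^ 2 * V / 2) := by
        refine mul_le_mul_of_nonneg_left ?_ (Real.exp_pos _).le
        exact Finset.prod_le_prod (fun i _ => mgf_nonneg) fun i _ => hone i
    _ = _ := by
        rw [Finset.prod_const, ← Real.exp_nat_mul, ← Real.exp_add, Finset.card_univ]
        congr 1
        rw [hs]
        field_simp
        ring

/-- Products along two rows of a matrix with independent entries are independent. -/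
theorem indepFun_mul_rows {ι κ : Type*} {X : ι × κ → Ω → ℝ} (hind : iIndepFun X μ)
    (hX : ∀ p, AEMeasurable (X p) μ) (i k : ι) (s : Finset κ) (j : κ) (hj : j ∉ s) :
    IndepFun (fun ω => X (i, j) ω * X (k, j) ω) (∑ l ∈ s, fun ω => X (i, l) ω * X (k, l) ω) μ := by
  classical
  set S : Finset (ι × κ) := {i, k} ×ˢ {j}
  set T : Finset (ι × κ) := {i, k} ×ˢ s
  have hST : Disjoint S T := Finset.disjoint_product.2 (Or.inr (by simpa using hj))
  have h := hind.indepFun_finset₀ S T hST hX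
  have hi : (i, j) ∈ S := by simp [S]
  have hk : (k, j) ∈ S := by simp [S]
  have hi' : ∀ l : s, (i, l.1) ∈ T := fun l => by simp [T]
  have hk' : ∀ l : s, (k, l.1) ∈ T := fun l => by simp [T]
  have h2 := h.comp (φ := fun x : S → ℝ => x ⟨_, hi⟩ * x ⟨_, hk⟩)
    (ψ := fun x : T → ℝ => ∑ l ∈ s.attach, x ⟨_, hi' l⟩ * x ⟨_, hk' l⟩) (by fun_prop)
    (by fun_prop)
  convert h2 using 1
  · rfl
  ext ω
  rw [Finset.sum_apply]
  exact (Finset.sum_attach s fun l => X (i, l) ω * X (k, l) ω).symm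

end Concentration

/-! ### Integrals against step densities as linear statistics. -/

section StepDensity

/-- The half-open cell of the unit square on which the step density takes the value of the
entry `(i, j)`. -/
def stepCell (m n : ℕ) (i j : ℕ) : Set (ℝ × ℝ) :=
  Set.Ioc ((i : ℝ) / m) ((i + 1) / m) ×ˢ Set.Ioc ((j : ℝ) / n) ((j + 1) / n)

theorem ceil_mul_eq_iff {m : ℕ} (hm : 0 < m) (i : ℕ) (x : ℝ) :
    ⌈(m : ℝ) * x⌉ = (i : ℤ) + 1 ↔ x ∈ Set.Ioc ((i : ℝ) / m) ((i + 1) / m) := by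
  have hm' : (0 : ℝ) < m := Nat.cast_pos.2 hm
  rw [Int.ceil_eq_iff, Set.mem_Ioc, div_lt_iff₀ hm', le_div_iff₀ hm', mul_comm x]
  push_cast
  rw [add_sub_cancel_right]

theorem measureReal_stepCell {m n : ℕ} (hm : 0 < m) (hn : 0 < n) (i j : ℕ) :
    (volume : Measure (ℝ × ℝ)).real (stepCell m n i j) = 1 / (m * n) := by
  have hm' : (0 : ℝ) < m := Nat.cast_pos.2 hm
  have hn' : (0 : ℝ) < n := Nat.cast_pos.2 hn
  rw [stepCell, Measure.volume_eq_prod, measureReal_prod_prod, Real.volume_real_Ioc,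
    Real.volume_real_Ioc, ← sub_div, ← sub_div, add_sub_cancel_left, add_sub_cancel_left,
    max_eq_left (by positivity), max_eq_left (by positivity)]
  field_simp

theorem measurableSet_stepCell (m n i j : ℕ) : MeasurableSet (stepCell m n i j) :=
  measurableSet_Ioc.prod measurableSet_Ioc

theorem stepDensity_eq {m n : ℕ} (hm : 0 < m) (hn : 0 < n) (N : ℝ)
    (A : Matrix (Fin m) (Fin n) ℝ) (p : ℝ × ℝ) :
    stepDensity N A p = ∑ i : Fin m, ∑ j : Fin n,
      (m * n : ℝ) / N * A i j * (stepCell m n i j).indicator 1 p := by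
  rw [stepDensity, Finset.mul_sum]
  refine Finset.sum_congr rfl fun i _ => ?_
  rw [Finset.mul_sum]
  refine Finset.sum_congr rfl fun j _ => ?_
  have hiff : (⌈(m : ℝ) * p.1⌉ = (i : ℤ) + 1 ∧ ⌈(n : ℝ) * p.2⌉ = (j : ℤ) + 1)
      ↔ p ∈ stepCell m n i j := by
    rw [ceil_mul_eq_iff hm, ceil_mul_eq_iff hn]
    exact Set.mem_prod.symm
  by_cases h : p ∈ stepCell m n i j
  · rw [Set.indicator_of_mem h, if_pos (hiff.2 h), Pi.one_apply, mul_one]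
  · rw [Set.indicator_of_notMem h, if_neg (mt hiff.1 h), mul_zero, mul_zero]

instance isFiniteMeasure_restrict_unitSquare :
    IsFiniteMeasure ((volume : Measure (ℝ × ℝ)).restrict unitSquare) := by
  refine isFiniteMeasure_restrict.2 (IsCompact.measure_lt_top ?_).ne
  exact isCompact_Icc.prod isCompact_Icc

theorem ae_abs_le_supNorm {g : ℝ × ℝ → ℝ} (hg : MemLp g ⊤ (volume.restrict unitSquare)) :
    ∀ᵐ p ∂(volume.restrict unitSquare), |g p| ≤ supNorm g := by
  have hne := hg.2.ne
  filter_upwards [enorm_ae_le_eLpNormEssSup g (volume.restrict unitSquare)] with p hp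
  rw [supNorm, ← Real.norm_eq_abs, ← toReal_enorm]
  exact ENNReal.toReal_mono hne (by simpa using hp)

theorem abs_integral_indicator_stepCell_le {m n : ℕ} (hm : 0 < m) (hn : 0 < n) {g : ℝ × ℝ → ℝ}
    (hg : MemLp g ⊤ (volume.restrict unitSquare)) (i j : ℕ) :
    |∫ p in unitSquare, g p * (stepCell m n i j).indicator 1 p| ≤ supNorm g / (m * n) := by
  have hs0 : 0 ≤ supNorm g := ENNReal.toReal_nonneg
  have hc := measurableSet_stepCell m n i j
  calc |∫ p in unitSquare, g p * (stepCell m n i j).indicator 1 p|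
      ≤ ∫ p in unitSquare, (stepCell m n i j).indicator (fun _ => supNorm g) p := by
        rw [← Real.norm_eq_abs]
        refine norm_integral_le_of_norm_le ((integrable_const _).indicator hc) ?_
        filter_upwards [ae_abs_le_supNorm hg] with p hp
        by_cases h : p ∈ stepCell m n i j
        · simpa [h] using hp
        · simp [h]
    _ = (volume.restrict unitSquare).real (stepCell m n i j) * supNorm g := by
        rw [integral_indicator_const _ hc, smul_eq_mul]
    _ ≤ 1 / (m * n) * supNorm g := by
        refine mul_le_mul_of_nonneg_right ?_ hs0
        rw [← measureReal_stepCell hm hn i j, measureReal_restrict_apply hc]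
        refine measureReal_mono Set.inter_subset_left ?_
        rw [stepCell, Measure.volume_eq_prod, Measure.prod_prod, Real.volume_Ioc,
          Real.volume_Ioc]
        exact ENNReal.mul_ne_top ENNReal.ofReal_ne_top ENNReal.ofReal_ne_top
    _ = _ := by ring

/-- Testing a difference of step densities against `g` is a linear statistic of the matrices. -/
theorem exists_weights_integral_stepDensity {m n : ℕ} (hm : 0 < m) (hn : 0 < n) {N : ℝ}
    (hN : 0 < N) {g : ℝ × ℝ → ℝ} (hg : MemLp g ⊤ (volume.restrict unitSquare)) :
    ∃ G : Fin m → Fin n → ℝ, (∀ i j, |G i j| ≤ supNorm g / N) ∧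
      ∀ A B : Matrix (Fin m) (Fin n) ℝ,
        ∫ p in unitSquare, g p * (stepDensity N A p - stepDensity N B p)
          = ∑ i, ∑ j, G i j * (A i j - B i j) := by
  have hm' : (0 : ℝ) < m := Nat.cast_pos.2 hm
  have hn' : (0 : ℝ) < n := Nat.cast_pos.2 hn
  -- The weight is `m * n / N` times the integral of `g` over a cell; the cell has area `1 / (m *
  -- n)`, whence the bound `‖g‖ / N`.
  refine ⟨fun i j => m * n / N * ∫ p in unitSquare, g p * (stepCell m n i j).indicator 1 p,
    fun i j => ?_, fun A B => ?_⟩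
  · rw [abs_mul, abs_of_pos (by positivity)]
    refine (mul_le_mul_of_nonneg_left (abs_integral_indicator_stepCell_le hm hn hg i j)
      (by positivity)).trans_eq ?_
    field_simp
  · have hgi : Integrable g (volume.restrict unitSquare) := hg.integrable le_top
    have hint : ∀ i j : ℕ, Integrable (fun p => g p * (stepCell m n i j).indicator 1 p)
        (volume.restrict unitSquare) := fun i j => by
      refine (hgi.indicator (measurableSet_stepCell m n i j)).congr
        (Filter.Eventually.of_forall fun p => ?_)
      by_cases h : p ∈ stepCell m n i j <;> simp [h]
    have e : ∀ p, g p * (stepDensity N A p - stepDensity N B p) = ∑ i : Fin m, ∑ j : Fin n,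
        m * n / N * (A i j - B i j) * (g p * (stepCell m n i j).indicator 1 p) := fun p => by
      rw [stepDensity_eq hm hn, stepDensity_eq hm hn, ← Finset.sum_sub_distrib, Finset.mul_sum]
      refine Finset.sum_congr rfl fun i _ => ?_
      rw [← Finset.sum_sub_distrib, Finset.mul_sum]
      refine Finset.sum_congr rfl fun j _ => ?_
      ring
    simp_rw [e]
    have hI : ∀ (i : Fin m) (j : Fin n), Integrable (fun p : ℝ × ℝ => m * n / N *
        (A i j - B i j) * (g p * (stepCell m n i j).indicator 1 p))
        (volume.restrict unitSquare) := fun i j => (hint i j).const_mul _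
    rw [integral_finsetSum _ fun i _ => integrable_finsetSum _ fun j _ => hI i j]
    refine Finset.sum_congr rfl fun i _ => ?_
    rw [integral_finsetSum _ fun j _ => hI i j]
    refine Finset.sum_congr rfl fun j _ => ?_
    rw [integral_const_mul]
    ring

end StepDensity

/-! ### Elementary bounds on entries and on the smoothness parameter. -/

section Entries

variable {m n : ℕ}

theorem minEntry_le (L : Matrix (Fin m) (Fin n) ℝ) (i : Fin m) (j : Fin n) : minEntry L ≤ L i j :=
  ciInf_le (f := fun p : Fin m × Fin n => L p.1 p.2) (Set.finite_range _).bddBelow (i, j)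

theorem le_maxEntry (L : Matrix (Fin m) (Fin n) ℝ) (i : Fin m) (j : Fin n) : L i j ≤ maxEntry L :=
  le_ciSup (f := fun p : Fin m × Fin n => L p.1 p.2) (Set.finite_range _).bddAbove (i, j)

theorem minEntry_pos [Nonempty (Fin m)] [Nonempty (Fin n)] {L : Matrix (Fin m) (Fin n) ℝ}
    (hL : ∀ i j, 0 < L i j) : 0 < minEntry L := by
  obtain ⟨p, hp⟩ := exists_eq_ciInf_of_finite (f := fun p : Fin m × Fin n => L p.1 p.2)
  rw [minEntry, ← hp]
  exact hL _ _

theorem l1Norm_eq_sum {L : Matrix (Fin m) (Fin n) ℝ} (hL : ∀ i j, 0 < L i j) :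
    l1Norm L = ∑ i, ∑ j, L i j :=
  Finset.sum_congr rfl fun i _ => Finset.sum_congr rfl fun j _ => abs_of_pos (hL i j)

theorem mul_minEntry_le_l1Norm {L : Matrix (Fin m) (Fin n) ℝ} (hL : ∀ i j, 0 < L i j) :
    m * n * minEntry L ≤ l1Norm L := by
  rw [l1Norm_eq_sum hL]
  calc (m * n * minEntry L : ℝ) = ∑ _i : Fin m, ∑ _j : Fin n, minEntry L := by simp [mul_assoc]
    _ ≤ _ := Finset.sum_le_sum fun i _ => Finset.sum_le_sum fun j _ => minEntry_le L i j

theorem IsSmoothMargin.delta_le_one {δ : ℝ} {r : Fin m → ℝ} {c : Fin n → ℝ}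
    (h : IsSmoothMargin δ r c) (hN : 0 < total r) : δ ≤ 1 := by
  have hm : (m : ℝ) ≠ 0 := by
    rintro hm
    have : m = 0 := Nat.cast_eq_zero.1 hm
    subst this
    simp [total] at hN
  have h1 : ∑ _i : Fin m, δ * total r / m ≤ total r := Finset.sum_le_sum fun i _ => (h.2.2.1 i).1
  rw [Finset.sum_const, Finset.card_univ, Fintype.card_fin, nsmul_eq_mul,
    mul_div_cancel₀ _ hm] at h1
  exact le_of_mul_le_mul_right (by linarith) hN

end Entries

/-! ### Stability in terms of the constant `C_*`. -/

section Stability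

variable {m n : ℕ}

theorem rescaled_eq {A B : Matrix (Fin m) (Fin n) ℝ} {r : Fin m → ℝ} {c : Fin n → ℝ}
    (h : IsRescaling A r c B) : rescaled A r c = B := by
  have hex : ∃ B, IsRescaling A r c B := ⟨B, h⟩
  rw [rescaled, dif_pos hex]
  exact (Classical.choose_spec hex).unique h

theorem isRescaling_of_sums {A B : Matrix (Fin m) (Fin n) ℝ} {r : Fin m → ℝ} {c : Fin n → ℝ}
    {a : Fin m → ℝ} {b : Fin n → ℝ} (hA : ∀ i j, 0 ≤ A i j) (ha : ∀ i, 0 < a i)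
    (hb : ∀ j, 0 < b j) (hB : ∀ i j, B i j = a i * A i j * b j) (hrow : ∀ i, ∑ j, B i j = r i)
    (hcol : ∀ j, ∑ i, B i j = c j) : IsRescaling A r c B := by
  refine ⟨a, b, ha, hb, ?_, fun i j => ?_, hrow, hcol⟩
  · ext i j
    rw [hB, Matrix.mul_diagonal, Matrix.diagonal_mul]
  · rw [hB]
    exact mul_nonneg (mul_nonneg (ha i).le (hA i j)) (hb j).le

/-- A matrix which approximately has the margins `(r, c)` after rescaling by `a`, `b`, and whose
rows have large inner products, is scalable, and the rescaling is close to `a i * A i j * b j`. -/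
theorem isScalable_and_sum_abs_sub_le [Nonempty (Fin m)] [Nonempty (Fin n)]
    {L A : Matrix (Fin m) (Fin n) ℝ} {r : Fin m → ℝ} {c : Fin n → ℝ} {a : Fin m → ℝ}
    {b : Fin n → ℝ} {δ K ε : ℝ} (hsm : IsSmoothMargin δ r c) (hN : 0 < total r) (hK : 0 ≤ K)
    (hL : ∀ i j, 0 < L i j) (hA : ∀ i j, 0 ≤ A i j) (ha : ∀ i, 0 < a i) (hb : ∀ j, 0 < b j)
    (hab : ∀ i j, Real.exp (-(4 * K)) * (total r / l1Norm L) ≤ a i * b j) (hε0 : 0 ≤ ε)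
    (hε : 16 * stabilityConst L δ K * ε ≤ 1)
    (hrow : ∀ i, |∑ j, a i * A i j * b j - r i| ≤ ε * r i)
    (hcol : ∀ j, |∑ i, a i * A i j * b j - c j| ≤ ε * c j)
    (hgram : ∀ i k, i ≠ k → n * minEntry L ^ 2 / 2 ≤ ∑ j, A i j * A k j) :
    IsScalable A r c ∧ ∑ i, ∑ j, |rescaled A r c i j - a i * A i j * b j|
      ≤ 2 * (16 * stabilityConst L δ K * ε) * total r := by
  have hm0 : (0 : ℝ) < m := Nat.cast_pos.2 (Fin.pos_iff_nonempty.2 inferInstance)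
  have hn0 : (0 : ℝ) < n := Nat.cast_pos.2 (Fin.pos_iff_nonempty.2 inferInstance)
  have hδ1 := hsm.delta_le_one hN
  obtain ⟨⟨-, -, hrc⟩, hδ0, hr, hc⟩ := hsm
  set N := total r with hNdef
  have hNr : ∑ i, r i = N := rfl
  have hr0 : ∀ i, 0 < r i := fun i => lt_of_lt_of_le (by positivity) (hr i).1
  have hc0 : ∀ j, 0 < c j := fun j => lt_of_lt_of_le (by positivity) (hc j).1
  set S := l1Norm L with hS
  set l := minEntry L with hl
  have hl0 : 0 < l := minEntry_pos hL
  have hSl : m * n * l ≤ S := mul_minEntry_le_l1Norm hL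
  have hS0 : 0 < S := lt_of_lt_of_le (by positivity) hSl
  -- The Gram bound produced by the lower bounds on `a i * b j`, smoothness and row alignment; it is
  -- chosen so that `C_* = 1 + 9 / η`.
  set η := Real.exp (-(8 * K)) * (δ * (m * n * l) / S) ^ 2 / 2 with hη
  have hη0 : 0 < η := by positivity
  have hηδ : η ≤ δ / 2 := by
    have h1 : δ * (m * n * l) / S ≤ δ := by
      rw [div_le_iff₀ hS0]
      exact mul_le_mul_of_nonneg_left hSl hδ0.le
    have h2 : (δ * (m * n * l) / S) ^ 2 ≤ δ ^ 2 := pow_le_pow_left₀ (by positivity) h1 2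
    have h3 : Real.exp (-(8 * K)) ≤ 1 := Real.exp_le_one_iff.2 (by linarith)
    have h4 : Real.exp (-(8 * K)) * (δ * (m * n * l) / S) ^ 2 ≤ 1 * δ ^ 2 :=
      mul_le_mul h3 h2 (by positivity) zero_le_one
    rw [hη]
    nlinarith
  have hC : stabilityConst L δ K = 1 + 9 / η := by
    rw [stabilityConst, ← hl, ← hS, hη, Real.exp_neg]
    field_simp
    ring
  rw [hC] at hε ⊢
  have hε16 : ε ≤ 1 / 16 := by
    have : 0 ≤ 9 / η * ε := by positivity
    linarith
  set Y : Fin m → Fin n → ℝ := fun i j => a i * A i j * b j with hY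
  have hY0 : ∀ i j, 0 ≤ Y i j := fun i j => mul_nonneg (mul_nonneg (ha i).le (hA i j)) (hb j).le
  have hgram' : ∀ i k, η / Fintype.card (Fin m) ≤ ∑ j, Y i j * Y k j / (r i * c j) := by
    intro i k
    rw [Fintype.card_fin]
    by_cases hik : i = k
    · subst hik
      -- Diagonal entries need no randomness: Cauchy–Schwarz and the approximate row sum give at
      -- least `(15 / 16) ^ 2 * δ / m`, and `η ≤ δ / 2`.
      have h1 := Finset.sq_sum_div_le_sum_sq_div Finset.univ (Y i)
        (g := fun j => r i * c j) fun j _ => mul_pos (hr0 i) (hc0 j)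
      rw [← Finset.mul_sum, ← hrc, hNr] at h1
      simp_rw [← pow_two]
      refine le_trans ?_ h1
      have h2 : 15 / 16 * r i ≤ ∑ j, Y i j := by
        have := (abs_le.1 (hrow i)).1
        nlinarith [hr0 i]
      have h3 : (15 / 16 * r i) ^ 2 ≤ (∑ j, Y i j) ^ 2 :=
        pow_le_pow_left₀ (by have := hr0 i; positivity) h2 2
      calc η / m ≤ (15 / 16) ^ 2 * (δ * N / m) / N := by
            rw [show (15 / 16 : ℝ) ^ 2 * (δ * N / m) / N = (15 / 16) ^ 2 * δ / m by field_simp]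
            gcongr
            linarith
        _ ≤ (15 / 16) ^ 2 * r i / N := by
            have := (hr i).1
            gcongr
        _ = (15 / 16 * r i) ^ 2 / (r i * N) := by
            have := (hr0 i).ne'
            field_simp
        _ ≤ _ := div_le_div_of_nonneg_right h3 (mul_pos (hr0 i) hN).le
    · have hterm : ∀ j, Real.exp (-(8 * K)) * δ ^ 2 * (m * n) / S ^ 2 * (A i j * A k j)
          ≤ Y i j * Y k j / (r i * c j) := fun j => by
        have h1 : r i * c j ≤ N / (δ * m) * (N / (δ * n)) :=
          mul_le_mul (hr i).2 (hc j).2 (hc0 j).le (by positivity)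
        have h2 : (Real.exp (-(4 * K)) * (N / S)) * (Real.exp (-(4 * K)) * (N / S))
            ≤ (a i * b j) * (a k * b j) :=
          mul_le_mul (hab i j) (hab k j) (by positivity) (mul_pos (ha i) (hb j)).le
        have h3 : 0 ≤ A i j * A k j := mul_nonneg (hA i j) (hA k j)
        rw [le_div_iff₀ (mul_pos (hr0 i) (hc0 j))]
        calc _ ≤ Real.exp (-(8 * K)) * δ ^ 2 * (m * n) / S ^ 2 * (A i j * A k j)
              * (N / (δ * m) * (N / (δ * n))) := by gcongr
          _ = (Real.exp (-(4 * K)) * (N / S)) * (Real.exp (-(4 * K)) * (N / S))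
              * (A i j * A k j) := by
              rw [show -(8 * K) = -(4 * K) + -(4 * K) by ring, Real.exp_add]
              field_simp
          _ ≤ (a i * b j) * (a k * b j) * (A i j * A k j) :=
              mul_le_mul_of_nonneg_right h2 h3
          _ = Y i j * Y k j := by rw [hY]; ring
      refine le_trans ?_ (Finset.sum_le_sum fun j _ => hterm j)
      rw [← Finset.mul_sum]
      refine le_trans ?_ (mul_le_mul_of_nonneg_left (hgram i k hik) (by positivity))
      rw [hη]
      refine le_of_eq ?_
      field_simp
  obtain ⟨u, v, h1, h2, h3⟩ := exists_scaling_of_approx hY0 hr0 hc0 hrc hε0 hη0 (by linarith) hε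
    hrow hcol hgram'
  have hres : IsRescaling A r c (fun i j => Y i j * Real.exp (u i + v j)) :=
    isRescaling_of_sums (a := fun i => a i * Real.exp (u i)) (b := fun j => b j * Real.exp (v j))
      hA (fun i => mul_pos (ha i) (Real.exp_pos _)) (fun j => mul_pos (hb j) (Real.exp_pos _))
      (fun i j => by rw [Real.exp_add]; simp only [hY]; ring) h1 h2
  refine ⟨⟨hA, _, hres⟩, ?_⟩
  rw [rescaled_eq hres]
  have hterm : ∀ i j, |Y i j * Real.exp (u i + v j) - a i * A i j * b j|
      ≤ 2 * (16 * (1 + 9 / η) * ε) * (Y i j * Real.exp (u i + v j)) := fun i j => by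
    -- The error is measured relative to the exact rescaling, whose total mass is exactly `N`.
    have e : Y i j * Real.exp (u i + v j) - a i * A i j * b j
        = -(Y i j * Real.exp (u i + v j) * (Real.exp (-(u i + v j)) - 1)) := by
      have : Real.exp (u i + v j) * Real.exp (-(u i + v j)) = 1 := by
        rw [← Real.exp_add, add_neg_cancel, Real.exp_zero]
      simp only [hY]
      linear_combination a i * A i j * b j * this
    have hp : 0 ≤ Y i j * Real.exp (u i + v j) := mul_nonneg (hY0 i j) (Real.exp_pos _).le
    rw [e, abs_neg, abs_mul, abs_of_nonneg hp, mul_comm]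
    refine mul_le_mul_of_nonneg_right ?_ hp
    have h4 : |-(u i + v j)| ≤ 16 * (1 + 9 / η) * ε := by rw [abs_neg]; exact h3 i j
    have h5 := Real.abs_exp_sub_one_le (h4.trans hε)
    linarith
  refine (Finset.sum_le_sum fun i _ => Finset.sum_le_sum fun j _ => hterm i j).trans_eq ?_
  simp_rw [← Finset.mul_sum, h1, hNr]

end Stability

/-! ### Concentration of linear statistics and of row inner products. -/

section RandomMatrix

variable {Ω : Type*} [MeasurableSpace Ω] {μ : Measure Ω} [IsProbabilityMeasure μ] {m n : ℕ}
  {X : Ω → Matrix (Fin m) (Fin n) ℝ} {L : Matrix (Fin m) (Fin n) ℝ} {σ R : ℝ}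

/-- Bernstein's inequality for linear statistics of a subexponential matrix. -/
theorem IsSubexponentialMatrix.measureReal_linear_statistic (hX : IsSubexponentialMatrix μ X L σ R)
    {κ : Type*} [Fintype κ] [Nonempty κ] {e : κ → Fin m × Fin n} (he : Function.Injective e)
    {w : κ → ℝ} {W τ : ℝ} (hτ : 0 ≤ τ) (hw : ∀ k, |w k| ≤ W) :
    μ.real {ω | W * (σ * Real.sqrt (2 * Fintype.card κ * τ) + R * τ)
      < |∑ k, w k * (X ω (e k).1 (e k).2 - L (e k).1 (e k).2)|} ≤ 2 * Real.exp (-τ) := by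
  refine measureReal_abs_le_exp_of_bernstein
    (Z := fun k ω => X ω (e k).1 (e k).2 - L (e k).1 (e k).2) ?_ ?_ ?_ ?_ ?_ hX.sigma_pos
    hX.scale_pos hτ hw
  · exact (hX.indep.precomp he).comp (fun k x => x - L (e k).1 (e k).2) fun k => by fun_prop
  · exact fun k => (hX.integrable _ _).sub (integrable_const _)
  · intro k
    rw [integral_sub (hX.integrable _ _) (integrable_const _), hX.mean]
    simp
  · exact fun k q hq => hX.moment_integrable _ _ q hq
  · exact fun k q hq => hX.moment_le _ _ q hq

theorem IsSubexponentialMatrix.integrable_sq (hX : IsSubexponentialMatrix μ X L σ R) (i : Fin m)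
    (j : Fin n) : Integrable (fun ω => X ω i j ^ 2) μ := by
  have h : Integrable (fun ω => |X ω i j - L i j| ^ 2 + (2 * L i j * X ω i j - L i j ^ 2)) μ :=
    (hX.moment_integrable i j 2 le_rfl).add
      (((hX.integrable i j).const_mul _).sub (integrable_const _))
  refine h.congr (Filter.Eventually.of_forall fun ω => ?_)
  simp only [sq_abs]
  ring

theorem IsSubexponentialMatrix.integral_sq_le (hX : IsSubexponentialMatrix μ X L σ R) (i : Fin m)
    (j : Fin n) : ∫ ω, X ω i j ^ 2 ∂μ ≤ σ ^ 2 + L i j ^ 2 := by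
  have h1 : Integrable (fun ω => 2 * L i j * X ω i j - L i j ^ 2) μ :=
    ((hX.integrable i j).const_mul _).sub (integrable_const _)
  have h2 := hX.moment_le i j 2 le_rfl
  calc ∫ ω, X ω i j ^ 2 ∂μ
      = ∫ ω, (|X ω i j - L i j| ^ 2 + (2 * L i j * X ω i j - L i j ^ 2)) ∂μ := by
        refine integral_congr_ae (Filter.Eventually.of_forall fun ω => ?_)
        simp only [sq_abs]
        ring
    _ = ∫ ω, |X ω i j - L i j| ^ 2 ∂μ + L i j ^ 2 := by
        rw [integral_add (hX.moment_integrable i j 2 le_rfl) h1,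
          integral_sub ((hX.integrable i j).const_mul _) (integrable_const _),
          integral_const_mul, hX.mean]
        simp
        ring
    _ ≤ _ := by
        rw [show (Nat.factorial 2 : ℝ) / 2 * σ ^ 2 * R ^ (2 - 2) = σ ^ 2 by simp] at h2
        linarith

/-- Two given rows of a subexponential matrix have a large inner product with high
probability. -/
theorem IsSubexponentialMatrix.measureReal_row_inner_le (hX : IsSubexponentialMatrix μ X L σ R)
    [Nonempty (Fin m)] [Nonempty (Fin n)] {i k : Fin m} (hik : i ≠ k) :
    μ.real {ω | ∑ j, X ω i j * X ω k j ≤ n * minEntry L ^ 2 / 2}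
      ≤ Real.exp (-(1 / 8 * rowAlignmentRate L σ R)) := by
  set l := minEntry L with hl
  have hl0 : 0 < l := minEntry_pos hX.mean_pos
  have hσ := hX.sigma_pos
  have hR := hX.scale_pos
  set Q := σ + R + maxEntry L with hQ
  have hLQ : ∀ i j, σ ^ 2 + L i j ^ 2 ≤ Q ^ 2 := fun i j => by
    have h1 := le_maxEntry L i j
    have h2 := hX.mean_pos i j
    nlinarith [mul_pos hσ h2, mul_pos hσ hR, mul_pos hR h2, mul_self_le_mul_self h2.le h1]
  have hQ0 : 0 < Q := by
    have := (hX.mean_pos i (Classical.arbitrary _)).trans_le (le_maxEntry L i _)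
    positivity
  have hind : ∀ j, IndepFun (fun ω => X ω i j) (fun ω => X ω k j) μ := fun j =>
    hX.indep.indepFun (i := (i, j)) (j := (k, j)) (by simpa using hik)
  have hind2 : ∀ j, IndepFun (fun ω => X ω i j ^ 2) (fun ω => X ω k j ^ 2) μ := fun j =>
    (hind j).comp (φ := fun x => x ^ 2) (ψ := fun x => x ^ 2) (by fun_prop) (by fun_prop)
  have h := measureReal_sum_le_half_le (μ := μ) (Z := fun j ω => X ω i j * X ω k j) (M := l ^ 2)
    (V := Q ^ 4) (fun j => (hind j).integrable_mul (hX.integrable i j) (hX.integrable k j))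
    (fun j => by
      simp_rw [mul_pow]
      exact (hind2 j).integrable_mul (hX.integrable_sq i j) (hX.integrable_sq k j))
    (fun j => by
      filter_upwards [hX.nonneg i j, hX.nonneg k j] with ω h1 h2 using mul_nonneg h1 h2)
    (fun s j hj => indepFun_mul_rows hX.indep (fun p => hX.aemeasurable p.1 p.2) i k s j hj)
    (by positivity) (by positivity)
    (fun j => by
      rw [(hind j).integral_fun_mul_eq_mul_integral (hX.aemeasurable i j).aestronglyMeasurable
        (hX.aemeasurable k j).aestronglyMeasurable, hX.mean, hX.mean, pow_two]
      exact mul_le_mul (minEntry_le L i j) (minEntry_le L k j) hl0.le (hX.mean_pos i j).le)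
    (fun j => by
      simp_rw [mul_pow]
      rw [(hind2 j).integral_fun_mul_eq_mul_integral
        (hX.integrable_sq i j).aestronglyMeasurable (hX.integrable_sq k j).aestronglyMeasurable,
        show Q ^ 4 = Q ^ 2 * Q ^ 2 by ring]
      exact mul_le_mul ((hX.integral_sq_le i j).trans (hLQ i j))
        ((hX.integral_sq_le k j).trans (hLQ k j)) (integral_nonneg fun ω => by positivity)
        (by positivity))
  rw [Fintype.card_fin] at h
  refine h.trans (Real.exp_le_exp.2 (neg_le_neg ?_))
  -- Only the first term of the minimum enters: the second-moment bound yields the rate `n * l ^ 4 /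
  -- (8 * Q ^ 4)`.
  have h1 : rowAlignmentRate L σ R ≤ n * (l ^ 4 / Q ^ 4) := min_le_left _ _
  calc 1 / 8 * rowAlignmentRate L σ R ≤ 1 / 8 * (n * (l ^ 4 / Q ^ 4)) := by gcongr
    _ = n * (l ^ 2) ^ 2 / (8 * Q ^ 4) := by field_simp

end RandomMatrix

theorem exp_neg_tau {m n : ℕ} (hm : 0 < m) (D : ℝ) :
    Real.exp (-tau m n D) = ((max m n : ℕ) : ℝ) ^ (-(D + 1)) / 4 := by
  have h : (0 : ℝ) < ((max m n : ℕ) : ℝ) := Nat.cast_pos.2 (lt_max_of_lt_left hm)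
  rw [tau, neg_add, Real.exp_add, Real.exp_neg (Real.log 4), Real.exp_log (by norm_num),
    Real.rpow_def_of_pos h, ← div_eq_mul_inv]
  ring_nf

theorem tau_pos {m n : ℕ} (hm : 0 < m) {D : ℝ} (hD : 0 < D) : 0 < tau m n D := by
  have h : (1 : ℝ) ≤ ((max m n : ℕ) : ℝ) := Nat.one_le_cast.2 (lt_max_of_lt_left hm)
  have h1 := Real.log_nonneg h
  have h2 : 0 < Real.log 4 := Real.log_pos (by norm_num)
  rw [tau]
  positivity

end MatrixScaling

end

/-! ### Union bound and conclusion. -/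

theorem mainTheorem11 :
    ∃ c₀ : ℝ, 0 < c₀ ∧
      ∀ {Ω : Type*} [MeasurableSpace Ω] (μ : Measure Ω) [IsProbabilityMeasure μ]
        (m n : ℕ) (_ : 0 < m) (_ : 0 < n)
        (r : Fin m → ℝ) (c : Fin n → ℝ) (δ : ℝ)
        (_ : MatrixScaling.IsSmoothMargin δ r c) (_ : 0 < MatrixScaling.total r)
        (X : Ω → Matrix (Fin m) (Fin n) ℝ) (L : Matrix (Fin m) (Fin n) ℝ) (σ R : ℝ)
        (_ : MatrixScaling.IsSubexponentialMatrix μ X L σ R)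
        (K : ℝ) (_ : MatrixScaling.BoundedCost r c L K)
        (g : ℝ × ℝ → ℝ) (_ : MemLp g ⊤ (volume.restrict MatrixScaling.unitSquare))
        (D : ℝ) (_ : 0 < D)
        (_ : MatrixScaling.epsPot L δ K σ R D ≤ 1),
        MatrixScaling.IsScalable L r c ∧
        1 - 2 * ((max m n : ℕ) : ℝ) ^ (-D)
            - (m : ℝ) ^ 2 * Real.exp (-(c₀ * MatrixScaling.rowAlignmentRate L σ R))
            - 2 * Real.exp (-((MatrixScaling.l1Norm L ^ 2 / 2) /
                (m * n * σ ^ 2 + R * MatrixScaling.l1Norm L)))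
          ≤ μ.real {ω | MatrixScaling.IsScalable (X ω) r c ∧
              |∫ p in MatrixScaling.unitSquare,
                  g p * (MatrixScaling.stepDensity (MatrixScaling.total r)
                            (MatrixScaling.rescaled (X ω) r c) p
                        - MatrixScaling.stepDensity (MatrixScaling.total r)
                            (MatrixScaling.rescaled L r c) p)|
                ≤ 2 * MatrixScaling.supNorm g * MatrixScaling.epsPot L δ K σ R D
                      * Real.exp (2 * K)
                  + MatrixScaling.supNorm g * Real.exp (2 * K) / MatrixScaling.l1Norm L
                      * (σ * Real.sqrt (2 * m * n * MatrixScaling.tau m n D)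
                          + 2 * R * MatrixScaling.tau m n D)} := by
  -- The constant is the `1 / 8` of the lower-tail bound `measureReal_sum_le_half_le`.
  refine ⟨1 / 8, by norm_num, ?_⟩
  intro Ω _ μ _ m n hm hn r c δ hsm hN X L σ R hX K hK g hg D hD heps
  have : Nonempty (Fin m) := Fin.pos_iff_nonempty.1 hm
  have : Nonempty (Fin n) := Fin.pos_iff_nonempty.1 hn
  have hm0 : (0 : ℝ) < m := Nat.cast_pos.2 hm
  have hn0 : (0 : ℝ) < n := Nat.cast_pos.2 hn
  have hL := hX.mean_pos
  have hσ := hX.sigma_pos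
  have hR := hX.scale_pos
  have hδ0 := hsm.2.1
  set N := MatrixScaling.total r with hNdef
  have hNr : ∑ i, r i = N := rfl
  have hNc : ∑ j, c j = N := hsm.1.2.2.symm
  have hr0 : ∀ i, 0 < r i := fun i => lt_of_lt_of_le (by positivity) (hsm.2.2.1 i).1
  have hc0 : ∀ j, 0 < c j := fun j => lt_of_lt_of_le (by positivity) (hsm.2.2.2 j).1
  set S := MatrixScaling.l1Norm L with hS
  have hS0 : 0 < S := lt_of_lt_of_le
    (mul_pos (mul_pos hm0 hn0) (MatrixScaling.minEntry_pos hL))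
    (MatrixScaling.mul_minEntry_le_l1Norm hL)
  set τ := MatrixScaling.tau m n D with hτdef
  have hτ : 0 < τ := MatrixScaling.tau_pos hm hD
  set s := MatrixScaling.supNorm g
  have hs0 : 0 ≤ s := ENNReal.toReal_nonneg
  -- the scaling of the mean
  obtain ⟨u, v, hu, hv⟩ := MatrixScaling.exists_scaling_of_pos hL hr0 hc0 (hNr.trans hNc.symm)
  set a : Fin m → ℝ := fun i => Real.exp (u i)
  set b : Fin n → ℝ := fun j => Real.exp (v j)
  have ha : ∀ i, 0 < a i := fun i => Real.exp_pos _
  have hb : ∀ j, 0 < b j := fun j => Real.exp_pos _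
  have hab_eq : ∀ i j, a i * L i j * b j = L i j * Real.exp (u i + v j) := fun i j => by
    simp only [a, b]
    rw [Real.exp_add]
    ring
  have hLrow : ∀ i, ∑ j, a i * L i j * b j = r i := fun i => by simp_rw [hab_eq, hu]
  have hLcol : ∀ j, ∑ i, a i * L i j * b j = c j := fun j => by simp_rw [hab_eq, hv]
  have hLres : MatrixScaling.IsRescaling L r c (fun i j => a i * L i j * b j) :=
    MatrixScaling.isRescaling_of_sums (fun i j => (hL i j).le) ha hb (fun _ _ => rfl) hLrow hLcol
  refine ⟨⟨fun i j => (hL i j).le, _, hLres⟩, ?_⟩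
  have hbd := MatrixScaling.scaling_factor_bounds hL hr0 hc0 ha hb hN hS0
    (MatrixScaling.l1Norm_eq_sum hL).symm hNr hNc hLrow hLcol hK.2
  have hab_lo : ∀ i j, Real.exp (-(4 * K)) * (N / S) ≤ a i * b j := fun i j =>
    le_trans (mul_le_mul_of_nonneg_right (Real.exp_le_exp.2 (by linarith [hK.1]))
      (by positivity)) (hbd i j).1
  set W := Real.exp (2 * K) * (N / S) with hW
  have hW0 : 0 < W := by positivity
  have hab_abs : ∀ i j, |a i * b j| ≤ W := fun i j => by
    rw [abs_of_pos (mul_pos (ha i) (hb j))]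
    exact (hbd i j).2
  obtain ⟨G, hG, hGint⟩ := MatrixScaling.exists_weights_integral_stepDensity hm hn hN hg
  -- the exceptional events
  set Erow : Fin m → Set Ω := fun i => {ω | W * (σ * Real.sqrt (2 * n * τ) + R * τ)
    < |∑ j, a i * b j * (X ω i j - L i j)|} with hErow
  set Ecol : Fin n → Set Ω := fun j => {ω | W * (σ * Real.sqrt (2 * m * τ) + R * τ)
    < |∑ i, a i * b j * (X ω i j - L i j)|} with hEcol
  set Egram : Fin m × Fin m → Set Ω := fun q => {ω | q.1 ≠ q.2 ∧
    ∑ j, X ω q.1 j * X ω q.2 j ≤ n * MatrixScaling.minEntry L ^ 2 / 2} with hEgram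
  set Elin : Set Ω := {ω | s / N * W * (σ * Real.sqrt (2 * (m * n) * τ) + R * τ)
    < |∑ i, ∑ j, G i j * (a i * b j) * (X ω i j - L i j)|} with hElin
  set Eneg : Set Ω := {ω | ¬ ∀ i j, 0 ≤ X ω i j} with hEneg
  have hProw : ∀ i, μ.real (Erow i) ≤ 2 * Real.exp (-τ) := fun i => by
    have h := hX.measureReal_linear_statistic (e := fun j : Fin n => (i, j))
      (fun _ _ h => (Prod.mk.inj h).2) hτ.le (hab_abs i)
    rwa [Fintype.card_fin] at h
  have hPcol : ∀ j, μ.real (Ecol j) ≤ 2 * Real.exp (-τ) := fun j => by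
    have h := hX.measureReal_linear_statistic (e := fun i : Fin m => (i, j))
      (fun _ _ h => (Prod.mk.inj h).1) hτ.le (fun i => hab_abs i j)
    rwa [Fintype.card_fin] at h
  have hPgram : ∀ q, μ.real (Egram q)
      ≤ Real.exp (-(1 / 8 * MatrixScaling.rowAlignmentRate L σ R)) := fun q => by
    by_cases hq : q.1 = q.2
    · simp [hEgram, hq, Real.exp_nonneg]
    · refine le_trans (measureReal_mono (fun ω hω => hω.2) (measure_ne_top μ _))
        (hX.measureReal_row_inner_le hq)
  have hPlin : μ.real Elin ≤ 2 * Real.exp (-τ) := by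
    have h := hX.measureReal_linear_statistic (e := fun p : Fin m × Fin n => p)
      (fun _ _ h => h) hτ.le (w := fun p => G p.1 p.2 * (a p.1 * b p.2)) (W := s / N * W)
      (fun p => by
        rw [abs_mul]
        exact mul_le_mul (hG _ _) (hab_abs _ _) (abs_nonneg _) (by positivity))
    simpa only [Fintype.card_prod, Fintype.card_fin, Nat.cast_mul, Fintype.sum_prod_type] using h
  have hPneg : μ.real Eneg = 0 := by
    rw [measureReal_eq_zero_iff]
    exact ae_iff.1 (ae_all_iff.2 fun i => ae_all_iff.2 fun j => hX.nonneg i j)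
  set E : Set Ω := (⋃ i, Erow i) ∪ (⋃ j, Ecol j) ∪ (⋃ q, Egram q) ∪ Elin ∪ Eneg with hE
  set M : ℝ := ((max m n : ℕ) : ℝ) with hM
  have hmM : (m : ℝ) ≤ M := Nat.cast_le.2 (le_max_left _ _)
  have hnM : (n : ℝ) ≤ M := Nat.cast_le.2 (le_max_right _ _)
  have hM1 : 1 ≤ M := Nat.one_le_cast.2 (lt_max_of_lt_left hm)
  have hM0 : 0 < M := one_pos.trans_le hM1
  have hPE : μ.real E ≤ 2 * M ^ (-D)
      + m ^ 2 * Real.exp (-(1 / 8 * MatrixScaling.rowAlignmentRate L σ R)) := by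
    have h1 : μ.real (⋃ i, Erow i) ≤ m * (2 * Real.exp (-τ)) :=
      (measureReal_iUnion_fintype_le _).trans
        ((Finset.sum_le_sum fun i _ => hProw i).trans_eq (by simp))
    have h2 : μ.real (⋃ j, Ecol j) ≤ n * (2 * Real.exp (-τ)) :=
      (measureReal_iUnion_fintype_le _).trans
        ((Finset.sum_le_sum fun i _ => hPcol i).trans_eq (by simp))
    have h3 : μ.real (⋃ q, Egram q)
        ≤ m ^ 2 * Real.exp (-(1 / 8 * MatrixScaling.rowAlignmentRate L σ R)) :=
      (measureReal_iUnion_fintype_le _).trans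
        ((Finset.sum_le_sum fun i _ => hPgram i).trans_eq (by simp [pow_two]))
    have h4 := measureReal_union_le (μ := μ) ((⋃ i, Erow i) ∪ (⋃ j, Ecol j) ∪ (⋃ q, Egram q) ∪ Elin)
      Eneg
    have h5 := measureReal_union_le (μ := μ) ((⋃ i, Erow i) ∪ (⋃ j, Ecol j) ∪ (⋃ q, Egram q)) Elin
    have h6 := measureReal_union_le (μ := μ) ((⋃ i, Erow i) ∪ (⋃ j, Ecol j)) (⋃ q, Egram q)
    have h7 := measureReal_union_le (μ := μ) (⋃ i, Erow i) (⋃ j, Ecol j)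
    -- There are `m + n + 1` Bernstein events and `exp (-τ) = M ^ (-(D + 1)) / 4`, so `m + n + 1 ≤ 3
    -- * M` absorbs the extra power of `M`.
    have h8 : (m + n + 1) * (2 * Real.exp (-τ)) ≤ 2 * M ^ (-D) := by
      rw [MatrixScaling.exp_neg_tau hm, ← hM, neg_add, Real.rpow_add hM0, Real.rpow_neg_one]
      have h9 : 0 < M ^ (-D) := Real.rpow_pos_of_pos hM0 _
      calc (m + n + 1) * (2 * (M ^ (-D) * M⁻¹ / 4))
          ≤ (M + M + M) * (2 * (M ^ (-D) * M⁻¹ / 4)) := by gcongr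
        _ = 3 / 2 * M ^ (-D) := by field_simp; ring
        _ ≤ 2 * M ^ (-D) := by linarith
    rw [hE]
    linarith
  -- outside the exceptional events the conclusion holds
  set ε := MatrixScaling.epsZero L δ K σ R D with hε
  have hε0 : 0 ≤ ε := by
    rw [hε, MatrixScaling.epsZero]
    positivity
  -- `k` is the number of summands in a row or column sum and `l` the number of rows or columns;
  -- smoothness turns the absolute Bernstein error into a relative one, at the cost of `1 ≤ M / l`.
  have hmargin : ∀ k l : ℝ, 0 < k → k ≤ M → 0 < l → l ≤ M → ∀ x, δ * N / l ≤ x →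
      W * (σ * Real.sqrt (2 * k * τ) + R * τ) ≤ ε * x := by
    intro k l hk hkM hl hlM x hx
    refine le_trans ?_ (mul_le_mul_of_nonneg_left hx hε0)
    calc W * (σ * Real.sqrt (2 * k * τ) + R * τ)
        ≤ W * (σ * Real.sqrt (2 * M * τ) + 2 * R * τ) := by
          have : R * τ ≤ 2 * R * τ := by nlinarith [mul_pos hR hτ]
          gcongr
      _ ≤ W * (σ * Real.sqrt (2 * M * τ) + 2 * R * τ) * (M / l) :=
          le_mul_of_one_le_right (by positivity) ((one_le_div hl).2 hlM)
      _ = ε * (δ * N / l) := by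
          rw [hε, MatrixScaling.epsZero, hW, ← hS, ← hM, ← hτdef]
          field_simp
  have hgood : Eᶜ ⊆ {ω | MatrixScaling.IsScalable (X ω) r c ∧
      |∫ p in MatrixScaling.unitSquare,
          g p * (MatrixScaling.stepDensity N (MatrixScaling.rescaled (X ω) r c) p
                - MatrixScaling.stepDensity N (MatrixScaling.rescaled L r c) p)|
        ≤ 2 * s * MatrixScaling.epsPot L δ K σ R D * Real.exp (2 * K)
          + s * Real.exp (2 * K) / S * (σ * Real.sqrt (2 * m * n * τ) + 2 * R * τ)} := by
    intro ω hω
    simp only [hE, Set.mem_compl_iff, Set.mem_union, Set.mem_iUnion, not_or, not_exists] at hω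
    obtain ⟨⟨⟨⟨h1, h2⟩, h3⟩, h4⟩, h5⟩ := hω
    have hA : ∀ i j, 0 ≤ X ω i j := not_not.1 h5
    have hrow : ∀ i, |∑ j, a i * X ω i j * b j - r i| ≤ ε * r i := fun i => by
      have e : ∑ j, a i * X ω i j * b j - r i = ∑ j, a i * b j * (X ω i j - L i j) := by
        rw [← hLrow i, ← Finset.sum_sub_distrib]
        exact Finset.sum_congr rfl fun j _ => by ring
      rw [e]
      exact (not_lt.1 (h1 i)).trans (hmargin n m hn0 hnM hm0 hmM _ (hsm.2.2.1 i).1)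
    have hcol : ∀ j, |∑ i, a i * X ω i j * b j - c j| ≤ ε * c j := fun j => by
      have e : ∑ i, a i * X ω i j * b j - c j = ∑ i, a i * b j * (X ω i j - L i j) := by
        rw [← hLcol j, ← Finset.sum_sub_distrib]
        exact Finset.sum_congr rfl fun j _ => by ring
      rw [e]
      exact (not_lt.1 (h2 j)).trans (hmargin m n hm0 hmM hn0 hnM _ (hsm.2.2.2 j).1)
    have hgram : ∀ i k, i ≠ k →
        n * MatrixScaling.minEntry L ^ 2 / 2 ≤ ∑ j, X ω i j * X ω k j := fun i k hik =>
      le_of_not_ge fun h => h3 (i, k) ⟨hik, h⟩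
    obtain ⟨hsc, hclose⟩ := MatrixScaling.isScalable_and_sum_abs_sub_le hsm hN hK.1 hL hA ha hb
      hab_lo hε0 heps hrow hcol hgram
    refine ⟨hsc, ?_⟩
    rw [hGint, MatrixScaling.rescaled_eq hLres]
    set B := MatrixScaling.rescaled (X ω) r c
    set ep := MatrixScaling.epsPot L δ K σ R D with hep
    have hep0 : 0 ≤ ep := by
      rw [hep, MatrixScaling.epsPot, MatrixScaling.stabilityConst]
      positivity
    -- The intermediate matrix is `Y = a X b`: the first sum is controlled by stability, the second
    -- by Bernstein's inequality.
    have hsplit : ∑ i, ∑ j, G i j * (B i j - a i * L i j * b j)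
        = ∑ i, ∑ j, G i j * (B i j - a i * X ω i j * b j)
          + ∑ i, ∑ j, G i j * (a i * b j) * (X ω i j - L i j) := by
      rw [← Finset.sum_add_distrib]
      refine Finset.sum_congr rfl fun i _ => ?_
      rw [← Finset.sum_add_distrib]
      exact Finset.sum_congr rfl fun j _ => by ring
    have hfirst : |∑ i, ∑ j, G i j * (B i j - a i * X ω i j * b j)|
        ≤ 2 * s * ep * Real.exp (2 * K) := by
      calc |∑ i, ∑ j, G i j * (B i j - a i * X ω i j * b j)|
          ≤ ∑ i, ∑ j, |G i j * (B i j - a i * X ω i j * b j)| :=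
            (Finset.abs_sum_le_sum_abs _ _).trans
              (Finset.sum_le_sum fun i _ => Finset.abs_sum_le_sum_abs _ _)
        _ ≤ ∑ i, ∑ j, s / N * |B i j - a i * X ω i j * b j| := by
            refine Finset.sum_le_sum fun i _ => Finset.sum_le_sum fun j _ => ?_
            rw [abs_mul]
            exact mul_le_mul_of_nonneg_right (hG i j) (abs_nonneg _)
        _ = s / N * ∑ i, ∑ j, |B i j - a i * X ω i j * b j| := by simp_rw [← Finset.mul_sum]
        _ ≤ s / N * (2 * ep * N) := mul_le_mul_of_nonneg_left hclose (by positivity)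
        _ = 2 * s * ep := by field_simp
        _ ≤ 2 * s * ep * Real.exp (2 * K) :=
            le_mul_of_one_le_right (by positivity) (Real.one_le_exp (by linarith [hK.1]))
    have hsecond : |∑ i, ∑ j, G i j * (a i * b j) * (X ω i j - L i j)|
        ≤ s * Real.exp (2 * K) / S * (σ * Real.sqrt (2 * m * n * τ) + 2 * R * τ) := by
      refine (not_lt.1 h4).trans ?_
      have e : s / N * W = s * Real.exp (2 * K) / S := by
        rw [hW]
        field_simp
      have : R * τ ≤ 2 * R * τ := by nlinarith [mul_pos hR hτ]
      rw [e, ← mul_assoc 2 (m : ℝ) n]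
      gcongr
    rw [hsplit]
    exact (abs_add_le _ _).trans (add_le_add hfirst hsecond)
  -- Subadditivity is enough here, so no measurability of the events is required.
  have huniv : 1 ≤ μ.real E + μ.real Eᶜ := by
    have h := measureReal_union_le (μ := μ) E Eᶜ
    rwa [Set.union_compl_self, probReal_univ] at h
  have hmono := measureReal_mono hgood (measure_ne_top μ _)
  -- The last exponential in the stated probability only weakens the bound; its positivity is all
  -- that is used.
  have hexp := Real.exp_pos (-((S ^ 2 / 2) / (m * n * σ ^ 2 + R * S)))
  linarith
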